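/- Let $M$ be a smooth $7$-manifold with a $G_2$-structure, i.e. a smooth $3$-form $\varphi$ that at each point is the pull-back, under some linear isomorphism $T_pM\cong\mathbb{R}^7$, of $\varphi_0=e^{123}+e^{145}+e^{167}+e^{246}-e^{257}-e^{347}-e^{356}$. Let $g$ and $\mathrm{vol}$ be the associated Riemannian metric and volume form, $g(u,v)\,\mathrm{vol}=\frac16(u\lrcorner\varphi)\wedge(v\lrcorner\varphi)\wedge\varphi$, let $\nabla$ be the Levi-Civita connection of $g$, $\psi=*\varphi$, and let $T_a{}^m=\frac1{48}(\nabla_a\varphi_{bcd})\psi^{mbcd}$ be the full torsion tensor (so that $\nabla_a\varphi_{bcd}=2T_a{}^e\psi_{ebcd}$). The Ricci tensor is $\mathrm{Ric}_{jl}=g^{ik}\mathrm{Riem}_{ijkl}$, where $\mathrm{Riem}_{ijkl}=g(R(\partial_i,\partial_j)\partial_l,\partial_k)$ and $R(X,Y)=[\nabla_X,\nabla_Y]-\nabla_{[X,Y]}$. On the octonion bundle $\mathbb{O}M=\Lambda^0\oplus TM$ consider the product $(a,\alpha)(b,\beta)=(ab-g(\alpha,\beta),\,a\beta+b\alpha+\alpha\times\beta)$,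 where $g(\alpha\times\beta,\gamma)=\varphi(\alpha,\beta,\gamma)$. Let $\delta_i=(0,\partial_i)$ and $\delta^i=g^{ij}\delta_j$, and regard $T$ as the $\mathrm{Im}\,\mathbb{O}M$-valued $1$-form $T_a=(0,T_a{}^m\partial_m)$. For sections $A$ of $\mathbb{O}M$ let $D_XA=\nabla_XA-A\,T_X$ and $\slashed{D}A=\delta^i(D_iA)$. For $\mathbb{O}M$-valued $1$-forms $P$ let $D_iP_a=\nabla_iP_a-P_aT_i$, with $\nabla$ the Levi-Civita connection on $T^*M\otimes\mathbb{O}M$, let $(\slashed{D}P)_a=\delta^i(D_iP_a)$, and let $(d_DP)(X,Y)=D_X(P(Y))-D_Y(P(X))-P([X,Y])$ be the octonionic covariant exterior derivative. Put $\widehat{\mathrm{Ric}}_j=\mathrm{Ric}_{jl}\,\delta^l$. Then, as $\mathbb{O}M$-valued $1$-forms on $M$, $$\tfrac12\widehat{\mathrm{Ric}}_j=-\delta^i\big((d_DT)_{ij}\big)=-(\slashed{D}T)_j-D_j(\slashed{D}1).$$ -/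

import Mathlib

open scoped Manifold ContDiff

noncomputable section

/-- The model space `ℝ⁷`. -/
abbrev R7 : Type := EuclideanSpace ℝ (Fin 7)

namespace G2

/-- The value `(eⁱ ∧ eʲ ∧ eᵏ)(u, v, w)` of an elementary 3-form on `ℝ⁷`. -/
def elem3 (i j k : Fin 7) (u v w : R7) : ℝ :=
  !![u i, u j, u k; v i, v j, v k; w i, w j, w k].det

/-- The model 3-form `e¹²³ + e¹⁴⁵ + e¹⁶⁷ + e²⁴⁶ - e²⁵⁷ - e³⁴⁷ - e³⁵⁶` on `ℝ⁷` (indices are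
shifted by one), whose stabilizer in `GL(7, ℝ)` is the group `G₂`. -/
def phi0 (u v w : R7) : ℝ :=
  elem3 0 1 2 u v w + elem3 0 3 4 u v w + elem3 0 5 6 u v w + elem3 1 3 5 u v w
    - elem3 1 4 6 u v w - elem3 2 3 6 u v w - elem3 2 4 5 u v w

/-- The coordinate vector `∂ᵢ` of the chart `e` at the point with coordinates `y`. -/
def coordVec {M : Type*} [TopologicalSpace M] [ChartedSpace R7 M]
    (e : OpenPartialHomeomorph M R7) (y : R7) (i : Fin 7) : TangentSpace (𝓡 7) (e.symm y) :=
  mfderiv (𝓡 7) (𝓡 7) e.symm y (EuclideanSpace.single i (1 : ℝ) : R7)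

end G2

/-- A `G₂`-structure on a smooth 7-manifold: a smooth 3-form that at every point is the pull-back of
the model form `phi0` along some linear isomorphism `T_pM ≃ ℝ⁷` (a positive 3-form). -/
structure G2Structure (M : Type*) [TopologicalSpace M] [ChartedSpace R7 M]
    [IsManifold (𝓡 7) ∞ M] where
  /-- the 3-form -/
  form : ∀ p : M, TangentSpace (𝓡 7) p [⋀^Fin 3]→L[ℝ] ℝ
  smooth : ∀ e ∈ IsManifold.maximalAtlas (𝓡 7) ∞ M, ∀ i j k : Fin 7,
    ContDiffOn ℝ ∞
      (fun y : R7 =>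
        form (e.symm y) ![G2.coordVec e y i, G2.coordVec e y j, G2.coordVec e y k]) e.target
  positive : ∀ p : M, ∃ L : TangentSpace (𝓡 7) p ≃ₗ[ℝ] R7,
    ∀ u v w : TangentSpace (𝓡 7) p, form p ![u, v, w] = G2.phi0 (L u) (L v) (L w)

namespace G2

/-- Component functions `φᵢⱼₖ(y)` of a 3-form on a coordinate domain. -/
abbrev Form3 : Type := R7 → Fin 7 → Fin 7 → Fin 7 → ℝ

/-- The components `φᵢⱼₖ = φ(∂ᵢ, ∂ⱼ, ∂ₖ)` of a `G₂`-structure in the chart `e`. -/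
def components {M : Type*} [TopologicalSpace M] [ChartedSpace R7 M] [IsManifold (𝓡 7) ∞ M]
    (Φ : G2Structure M) (e : OpenPartialHomeomorph M R7) : Form3 :=
  fun y i j k => Φ.form (e.symm y) ![coordVec e y i, coordVec e y j, coordVec e y k]

/-- The partial derivative `∂ᵢ f`. -/
def pd (i : Fin 7) (f : R7 → ℝ) (y : R7) : ℝ :=
  fderiv ℝ f y (EuclideanSpace.single i 1)

/-- The permutation symbol `ε` on seven indices. -/
def eps (s : Fin 7 → Fin 7) : ℝ :=
  ((1 : Matrix (Fin 7) (Fin 7) ℝ).submatrix s id).det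

/-! All objects below live on a coordinate domain and are built from the components `φ` of the
3-form. Tensors are given by their components in the coordinate frame. -/

section Geometry

variable (φ : Form3)

/-- `Bᵢⱼ`: the coefficient of `dy¹ ∧ ⋯ ∧ dy⁷` in `(1/6) (∂ᵢ ⌟ φ) ∧ (∂ⱼ ⌟ φ) ∧ φ`. In general
the coefficient of `α ∧ β ∧ γ` is `1/(2! 2! 3!) ∑ sgn(σ) α_{σ0 σ1} β_{σ2 σ3} γ_{σ4 σ5 σ6}`. -/
def B (y : R7) : Matrix (Fin 7) (Fin 7) ℝ :=
  Matrix.of fun i j =>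
    (1 / 6 : ℝ) * ((1 / 24 : ℝ) * ∑ σ : Equiv.Perm (Fin 7), ((Equiv.Perm.sign σ : ℤ) : ℝ) *
      (φ y i (σ 0) (σ 1) * φ y j (σ 2) (σ 3) * φ y (σ 4) (σ 5) (σ 6)))

/-- The coefficient `v` of the volume form `vol = v dy¹ ∧ ⋯ ∧ dy⁷` of `φ`. The equations
`gᵢⱼ v = Bᵢⱼ` and `v² = det g` say that `v` is the real ninth root of `det B`; it is negative if
the coordinates do not have the orientation of `φ`. -/
def vol (y : R7) : ℝ :=
  SignType.sign (B φ y).det * |(B φ y).det| ^ (1 / 9 : ℝ)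

/-- The metric `gᵢⱼ` associated with `φ`, with
`g(u, v) vol = (1/6) (u ⌟ φ) ∧ (v ⌟ φ) ∧ φ`. -/
def g (y : R7) : Matrix (Fin 7) (Fin 7) ℝ :=
  Matrix.of fun i j => B φ y i j / vol φ y

/-- The inverse metric `gⁱʲ`. -/
def gInv (y : R7) : Matrix (Fin 7) (Fin 7) ℝ := (g φ y)⁻¹

/-- The Hodge dual 4-form `ψ = *φ`, `ψ_{abcd} = (1/3!) φ^{mnp} vol_{mnpabcd}`. -/
def psi (y : R7) (a b c d : Fin 7) : ℝ :=
  (1 / 6 : ℝ) * ∑ m, ∑ n, ∑ p,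
    (∑ m', ∑ n', ∑ p', gInv φ y m m' * gInv φ y n n' * gInv φ y p p' * φ y m' n' p') *
      (vol φ y * eps ![m, n, p, a, b, c, d])

/-- The Christoffel symbols `Γᵏᵢⱼ` of the Levi-Civita connection of `g`. -/
def Gam (k i j : Fin 7) (y : R7) : ℝ :=
  (1 / 2 : ℝ) * ∑ l, gInv φ y k l *
    (pd i (fun z => g φ z j l) y + pd j (fun z => g φ z i l) y - pd l (fun z => g φ z i j) y)

/-- The curvature components `R^k_{lij}`, `R(∂ᵢ, ∂ⱼ) ∂ₗ = R^k_{lij} ∂ₖ`, of the Levi-Civita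
connection, where `R(X, Y) = [∇_X, ∇_Y] - ∇_{[X, Y]}`. -/
def curv (k l i j : Fin 7) (y : R7) : ℝ :=
  pd i (Gam φ k j l) y - pd j (Gam φ k i l) y
    + ∑ m, (Gam φ k i m y * Gam φ m j l y - Gam φ k j m y * Gam φ m i l y)

/-- `Riem_{ijkl} = g(R(∂ᵢ, ∂ⱼ) ∂ₗ, ∂ₖ)`. -/
def Riem (i j k l : Fin 7) (y : R7) : ℝ := ∑ m, g φ y k m * curv φ m l i j y

/-- The Ricci tensor `Ric_{jl} = g^{ik} Riem_{ijkl}`. -/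
def Ric (j l : Fin 7) (y : R7) : ℝ := ∑ i, ∑ k, gInv φ y i k * Riem φ i j k l y

/-- The covariant derivative `∇ₐ φ_{bcd}` of the 3-form. -/
def nablaPhi (a b c d : Fin 7) (y : R7) : ℝ :=
  pd a (fun z => φ z b c d) y
    - ∑ q, (Gam φ q a b y * φ y q c d + Gam φ q a c y * φ y b q d + Gam φ q a d y * φ y b c q)

/-- The full torsion tensor `Tₐᵐ = (1/48) (∇ₐ φ_{bcd}) ψ^{mbcd}`. -/
def tors (a m : Fin 7) (y : R7) : ℝ :=
  (1 / 48 : ℝ) * ∑ b, ∑ c, ∑ d, nablaPhi φ a b c d y *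
    ∑ m', ∑ b', ∑ c', ∑ d',
      gInv φ y m m' * gInv φ y b b' * gInv φ y c c' * gInv φ y d d' * psi φ y m' b' c' d'

/-! ### The octonion bundle -/

/-- The fibre of the octonion bundle `𝕆M = Λ⁰ ⊕ TM` in the coordinate frame: a pair `(a, α)` of the
real part and of the components of the imaginary part, which is a tangent vector. -/
abbrev Oct : Type := ℝ × (Fin 7 → ℝ)

/-- The cross product `(α × β)ᵏ = φᵏᵢⱼ αⁱ βʲ`, that is `g(α × β, γ) = φ(α, β, γ)`. -/
def cross (y : R7) (α β : Fin 7 → ℝ) : Fin 7 → ℝ :=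
  fun k => ∑ l, gInv φ y k l * ∑ i, ∑ j, φ y i j l * α i * β j

/-- The octonion product `(a, α)(b, β) = (a b - ⟨α, β⟩, a β + b α + α × β)`. -/
def mul (y : R7) (A C : Oct) : Oct :=
  (A.1 * C.1 - ∑ i, ∑ j, g φ y i j * A.2 i * C.2 j, A.1 • C.2 + C.1 • A.2 + cross φ y A.2 C.2)

/-- The unit section `1` of the octonion bundle. -/
def one : R7 → Oct := fun _ => (1, 0)

/-- `δⁱ = gⁱʲ δⱼ`, where `δⱼ = (0, ∂ⱼ)` is the imaginary octonion given by `∂ⱼ`. -/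
def deltaUp (i : Fin 7) (y : R7) : Oct :=
  ∑ j, gInv φ y i j • ((0, Pi.single j 1) : Oct)

/-- The torsion as an `Im 𝕆M`-valued 1-form, `Tₐ = (0, Tₐᵐ)`. -/
def T (a : Fin 7) (y : R7) : Oct := (0, fun m => tors φ a m y)

/-- The Levi-Civita covariant derivative `∇ᵢ A` of a section `A` of `𝕆M = Λ⁰ ⊕ TM`. -/
def nabla (i : Fin 7) (A : R7 → Oct) (y : R7) : Oct :=
  (pd i (fun z => (A z).1) y,
    fun k => pd i (fun z => (A z).2 k) y + ∑ j, Gam φ k i j y * (A y).2 j)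

/-- The octonion covariant derivative `Dᵢ A = ∇ᵢ A - A Tᵢ` of a section `A`. -/
def D (i : Fin 7) (A : R7 → Oct) (y : R7) : Oct :=
  nabla φ i A y - mul φ y (A y) (T φ i y)

/-- The octonion Dirac operator `D̸ A = δⁱ (Dᵢ A)` on sections. -/
def Dirac (A : R7 → Oct) (y : R7) : Oct := ∑ i, mul φ y (deltaUp φ i y) (D φ i A y)

/-- The octonion covariant derivative `Dᵢ Pₐ = ∇ᵢ Pₐ - Pₐ Tᵢ` of an `𝕆M`-valued 1-form `P`, with
`∇` the Levi-Civita connection on `T*M ⊗ 𝕆M`. -/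
def DForm (i : Fin 7) (P : Fin 7 → R7 → Oct) (a : Fin 7) (y : R7) : Oct :=
  (nabla φ i (P a) y - ∑ k, Gam φ k i a y • P k y) - mul φ y (P a y) (T φ i y)

/-- The octonion Dirac operator `(D̸ P)ₐ = δⁱ (Dᵢ Pₐ)` on `𝕆M`-valued 1-forms. -/
def DiracForm (P : Fin 7 → R7 → Oct) (a : Fin 7) (y : R7) : Oct :=
  ∑ i, mul φ y (deltaUp φ i y) (DForm φ i P a y)

/-- The octonionic covariant exterior derivative of an `𝕆M`-valued 1-form,
`(d_D P)(X, Y) = D_X (P(Y)) - D_Y (P(X)) - P([X, Y])`, on `X = ∂ᵢ` and `Y = ∂ⱼ`. -/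
def dD (P : Fin 7 → R7 → Oct) (i j : Fin 7) (y : R7) : Oct :=
  D φ i (P j) y - D φ j (P i) y

/-- The Ricci tensor as an `Im 𝕆M`-valued 1-form, `(R̂ic)ⱼ = Ricⱼₗ δˡ`. -/
def RicHat (j : Fin 7) (y : R7) : Oct := ∑ l, Ric φ j l y • deltaUp φ l y

end Geometry

end G2

end

open scoped Matrix

noncomputable section

namespace G2

/-! ### Structure constants of the model 3-form and its dual 4-form -/

section

set_option maxRecDepth 100000

/-! The octonion product is not parallel for the Levi-Civita connection, but its derivative is an
associator: `(∇ᵢ μ)(A, B) = (AB)Tᵢ - A(B Tᵢ)` (`IsG2On.covMul_eq`). This is the equation `∇φ = 2Tψ`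
in disguise. Hence `Dᵢ(AB) = (∇ᵢA)B + A(DᵢB)` (`covD_mul`), and `[Dᵢ, Dⱼ]A = R(∂ᵢ, ∂ⱼ)A - A (d_D
T)ᵢⱼ` (`covD_comm`). Computing `[Dᵢ, Dⱼ](AB)` in two ways shows that the failure of `R(∂ᵢ, ∂ⱼ)` to
be a derivation of the octonions is the associator with `(d_D T)ᵢⱼ` (`curvOp_mul`).

Derivations form `g₂`, so only the seven-dimensional part of the curvature in `so(7) = g₂ ⊕ ℝ⁷`
matters. Contracting with `ψ` gives `(d_D T)ᵢⱼ = (1/4) φ · R(∂ᵢ, ∂ⱼ)` (`eq_of_derivation_defect`,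
`IsG2On.mulVec_dD_T`). Left multiplication by `δⁱ` then produces a `φφ` contraction, that is, `ψ`
plus Kronecker terms. The `φ` and `ψ` terms die by the first Bianchi identity, and the Kronecker
terms give `-Ric/2` (`sum_mul0_eq_ricci`).

The second equality is the product rule for `D` applied to `D̸1 = -δⁱTᵢ`, where `δ` is parallel
(`IsG2On.sum_deltaUp_mul_dD`).

The equation `∇φ = 2Tψ` is itself derived from alternativity. Differentiating `a(ab) = (aa)b` forces
the components of `∇ᵢφ` in the 1- and 27-dimensional parts of `Λ³` to vanish (`covMul_alternative`,
`antisymm_of_alternative`, `torsion_of_antisymm`).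

All derivatives are taken in coordinates. At each point a matrix `L` with `φ = L^*φ₀` transports the
resulting algebraic identities to the standard octonions, so the frames need not depend smoothly on
the point. -/

/-- The structure constants of `phi0`: with one-based indices, `φ₀(eₐ, e_b, e_c)` is nonzero exactly
when `a ≠ b` and `c` is the bitwise sum of `a` and `b`; the bits of the numeral are its signs. -/
def phiZ (a b c : Fin 7) : ℤ :=
  if a ≠ b ∧ Nat.xor (a.val + 1) (b.val + 1) = c.val + 1 then
    (if 112770651022890 / 2 ^ (7 * a.val + b.val) % 2 = 1 then 1 else -1) else 0

/-- The Kronecker symbol. -/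
def dZ (a b : Fin 7) : ℤ := if a = b then 1 else 0

/-- The components of the 4-form dual to `phi0`. -/
def psiZ (a b c d : Fin 7) : ℤ :=
  ∑ k, phiZ a b k * phiZ c d k - dZ a c * dZ b d + dZ a d * dZ b c

theorem phiZ_swap₁₂ : ∀ a b c, phiZ b a c = -phiZ a b c := by decide +kernel

theorem phiZ_swap₂₃ : ∀ a b c, phiZ a c b = -phiZ a b c := by decide +kernel

theorem psiZ_swap : ∀ a b c d, psiZ b a c d = -psiZ a b c d ∧ psiZ a c b d = -psiZ a b c d ∧
    psiZ a b d c = -psiZ a b c d := by decide +kernel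

end

/-! ### Reduction to increasing indices, and a computable permutation symbol -/

section

set_option maxRecDepth 100000

/-- Sorting the indices costs only signs. An identity between 3-forms on `ℝ⁷` is thereby reduced to
35 cases instead of 343. -/
theorem eq_zero_of_antisymm₃ {n : ℕ} {A : Fin n → Fin n → Fin n → ℝ}
    (h₁ : ∀ a b c, A b a c = -A a b c) (h₂ : ∀ a b c, A a c b = -A a b c)
    (h : ∀ a b c, a < b → b < c → A a b c = 0) (a b c : Fin n) : A a b c = 0 := by
  have z₁ : ∀ a b, A a a b = 0 := fun a b => by linarith [h₁ a a b]
  have z₂ : ∀ a b, A a b b = 0 := fun a b => by linarith [h₂ a b b]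
  have s : ∀ a b c, b < c → A a b c = 0 := by
    intro a b c hbc
    rcases lt_trichotomy a b with hab | rfl | hab
    · exact h a b c hab hbc
    · exact z₁ _ _
    · rw [h₁, neg_eq_zero]
      rcases lt_trichotomy a c with hac | rfl | hac
      · exact h b a c hab hac
      · exact z₂ _ _
      · rw [h₂, h b c a hbc hac, neg_zero]
  rcases lt_trichotomy b c with hbc | rfl | hbc
  · exact s a b c hbc
  · exact z₂ _ _
  · rw [h₂, s a c b hbc, neg_zero]

theorem eq_zero_of_antisymm₄ {n : ℕ} {A : Fin n → Fin n → Fin n → Fin n → ℝ}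
    (h₁ : ∀ a b c d, A b a c d = -A a b c d) (h₂ : ∀ a b c d, A a c b d = -A a b c d)
    (h₃ : ∀ a b c d, A a b d c = -A a b c d)
    (h : ∀ a b c d, a < b → b < c → c < d → A a b c d = 0) (a b c d : Fin n) :
    A a b c d = 0 := by
  have z₁ : ∀ a b c, A a a b c = 0 := fun a b c => by linarith [h₁ a a b c]
  have z₂ : ∀ a b c, A a b b c = 0 := fun a b c => by linarith [h₂ a b b c]
  have z₃ : ∀ a b c, A a b c c = 0 := fun a b c => by linarith [h₃ a b c c]
  have s : ∀ b c d, b < c → c < d → ∀ a, A a b c d = 0 := by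
    intro b c d hbc hcd a
    rcases lt_trichotomy a b with hab | rfl | hab
    · exact h a b c d hab hbc hcd
    · exact z₁ _ _ _
    · rw [h₁, neg_eq_zero]
      rcases lt_trichotomy a c with hac | rfl | hac
      · exact h b a c d hab hac hcd
      · exact z₂ _ _ _
      · rw [h₂, neg_eq_zero]
        rcases lt_trichotomy a d with had | rfl | had
        · exact h b c a d hbc hac had
        · exact z₃ _ _ _
        · rw [h₃, h b c d a hbc hcd had, neg_zero]
  exact eq_zero_of_antisymm₃ (A := A a) (h₂ a) (h₃ a) (fun b c d hbc hcd => s b c d hbc hcd a) b c d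

/-- The permutation symbol as a computable integer. -/
def epsZ (s : Fin 7 → Fin 7) : ℤ :=
  if (List.ofFn s).Nodup then ∏ i, ∏ j, if i < j then (if s i < s j then 1 else -1) else 1 else 0

/-- This identifies `psiZ`, defined through a contraction of `phiZ` with itself, with the Hodge
dual. Restricting to increasing indices and skipping the zeros of `phiZ` keeps the evaluation small.
-/
theorem sum_phiZ_epsZ : ∀ a b c d : Fin 7, a < b → b < c → c < d → 
    (∑ m, ∑ n, ∑ p, if phiZ m n p = 0 then 0 else phiZ m n p * epsZ ![m, n, p, a, b, c, d])
      = 6 * psiZ a b c d := by decide +kernel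

end

/-! ### Signed sums over permutations -/

section

theorem sum_fun_succ {α : Type*} [Fintype α] {n : ℕ} (X : (Fin (n + 1) → α) → ℝ) :
    ∑ s, X s = ∑ a, ∑ s : Fin n → α, X (Matrix.vecCons a s) := by
  rw [← (Fin.consEquiv (fun _ => α)).sum_comp, Fintype.sum_prod_type]
  rfl

theorem sum_fun_zero {α : Type*} [Fintype α] (X : (Fin 0 → α) → ℝ) : ∑ s, X s = X ![] := by
  rw [Fintype.sum_unique]
  exact congrArg X (Subsingleton.elim _ _)

theorem epsZ_perm (σ : Equiv.Perm (Fin 7)) : epsZ σ = Equiv.Perm.sign σ := by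
  rw [Equiv.Perm.sign_eq_prod_prod_Ioi σ, epsZ, if_pos (List.nodup_ofFn.2 σ.injective)]
  simp only [← Finset.prod_filter, Units.coe_prod]
  refine Finset.prod_congr rfl fun i _ => Finset.prod_congr ?_ fun j _ => ?_
  · ext j; simp
  · split_ifs <;> rfl

theorem epsZ_of_not_injective {s : Fin 7 → Fin 7} (h : ¬ Function.Injective s) : epsZ s = 0 := by
  rw [epsZ, if_neg (by rwa [List.nodup_ofFn])]

theorem exists_perm_of_injective {s : Fin 7 → Fin 7} (h : Function.Injective s) :
    ∃ σ : Equiv.Perm (Fin 7), ⇑σ = s :=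
  ⟨Equiv.ofBijective s (Finite.injective_iff_bijective.1 h), rfl⟩

theorem epsZ_comp_swap (s : Fin 7 → Fin 7) {i j : Fin 7} (hij : i ≠ j) :
    epsZ (s ∘ Equiv.swap i j) = -epsZ s := by
  by_cases h : Function.Injective s
  · obtain ⟨σ, rfl⟩ := exists_perm_of_injective h
    rw [← Equiv.Perm.coe_mul, epsZ_perm, epsZ_perm, Equiv.Perm.sign_mul, Equiv.Perm.sign_swap hij]
    simp
  · rw [epsZ_of_not_injective h, epsZ_of_not_injective, neg_zero]
    rwa [Function.Injective.of_comp_iff' _ (Equiv.swap i j).bijective]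

theorem epsZ_swap (m n p a b c d : Fin 7) :
    epsZ ![m, n, p, b, a, c, d] = -epsZ ![m, n, p, a, b, c, d] ∧
    epsZ ![m, n, p, a, c, b, d] = -epsZ ![m, n, p, a, b, c, d] ∧
    epsZ ![m, n, p, a, b, d, c] = -epsZ ![m, n, p, a, b, c, d] := by
  refine ⟨?_, ?_, ?_⟩
  · rw [← epsZ_comp_swap _ (show (3 : Fin 7) ≠ 4 by decide)]
    congr 1; ext i; fin_cases i <;> rfl
  · rw [← epsZ_comp_swap _ (show (4 : Fin 7) ≠ 5 by decide)]
    congr 1; ext i; fin_cases i <;> rfl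
  · rw [← epsZ_comp_swap _ (show (5 : Fin 7) ≠ 6 by decide)]
    congr 1; ext i; fin_cases i <;> rfl

theorem sum_epsZ_phiZ (a b c d : Fin 7) :
    ∑ m, ∑ n, ∑ p, (epsZ ![m, n, p, a, b, c, d] : ℝ) * phiZ m n p = 6 * psiZ a b c d := by
  rw [← sub_eq_zero]
  refine eq_zero_of_antisymm₄ (A := fun a b c d => ∑ m, ∑ n, ∑ p,
    (epsZ ![m, n, p, a, b, c, d] : ℝ) * phiZ m n p - 6 * psiZ a b c d) ?_ ?_ ?_ ?_ a b c d
  · intro a b c d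
    simp only [(epsZ_swap _ _ _ a b c d).1, (psiZ_swap a b c d).1, Int.cast_neg, neg_mul,
      Finset.sum_neg_distrib]
    ring
  · intro a b c d
    simp only [(epsZ_swap _ _ _ a b c d).2.1, (psiZ_swap a b c d).2.1, Int.cast_neg, neg_mul,
      Finset.sum_neg_distrib]
    ring
  · intro a b c d
    simp only [(epsZ_swap _ _ _ a b c d).2.2, (psiZ_swap a b c d).2.2, Int.cast_neg, neg_mul,
      Finset.sum_neg_distrib]
    ring
  · intro a b c d hab hbc hcd
    rw [sub_eq_zero, ← Int.cast_ofNat, ← Int.cast_mul, ← sum_phiZ_epsZ a b c d hab hbc hcd]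
    push_cast
    refine Finset.sum_congr rfl fun m _ => Finset.sum_congr rfl fun n _ =>
      Finset.sum_congr rfl fun p _ => ?_
    split_ifs with h <;> simp [h, mul_comm]

/-- The symbol vanishes on non-injective maps, so the sum over permutations can be extended to
independent indices. -/
theorem sum_perm_sign_mul (X : (Fin 7 → Fin 7) → ℝ) :
    ∑ σ : Equiv.Perm (Fin 7), ((Equiv.Perm.sign σ : ℤ) : ℝ) * X σ = ∑ s, (epsZ s : ℝ) * X s := by
  refine Finset.sum_of_injOn (fun σ => (σ : Fin 7 → Fin 7)) ?_ ?_ ?_ ?_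
  · exact fun σ _ τ _ h => DFunLike.coe_injective h
  · simp
  · intro s _ hs
    rw [epsZ_of_not_injective, Int.cast_zero, zero_mul]
    intro h
    obtain ⟨σ, rfl⟩ := exists_perm_of_injective h
    exact hs ⟨σ, by simp, rfl⟩
  · intro σ _
    rw [epsZ_perm]

/-- Once the indices are independent, summing `ε` against `φ₀` in the first three slots leaves six
times the dual 4-form in the other four. -/
theorem sum_perm_phiZ (H : Fin 7 → Fin 7 → Fin 7 → Fin 7 → ℝ) :
    ∑ σ : Equiv.Perm (Fin 7), ((Equiv.Perm.sign σ : ℤ) : ℝ) *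
      (phiZ (σ 0) (σ 1) (σ 2) * H (σ 3) (σ 4) (σ 5) (σ 6)) =
      6 * ∑ a, ∑ b, ∑ c, ∑ d, (psiZ a b c d : ℝ) * H a b c d := by
  rw [sum_perm_sign_mul (fun s => phiZ (s 0) (s 1) (s 2) * H (s 3) (s 4) (s 5) (s 6))]
  have e : ∀ (F : Fin 7 → Fin 7 → Fin 7 → Fin 7 → Fin 7 → Fin 7 → Fin 7 → ℝ),
      ∑ m, ∑ n, ∑ p, ∑ a, ∑ b, ∑ c, ∑ d, F m n p a b c d
        = ∑ a, ∑ b, ∑ c, ∑ d, ∑ m, ∑ n, ∑ p, F m n p a b c d := by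
    intro F
    have := Finset.sum_comm (s := (Finset.univ : Finset (Fin 7 × Fin 7 × Fin 7)))
      (t := (Finset.univ : Finset (Fin 7 × Fin 7 × Fin 7 × Fin 7)))
      (f := fun x y => F x.1 x.2.1 x.2.2 y.1 y.2.1 y.2.2.1 y.2.2.2)
    simpa only [Fintype.sum_prod_type] using this
  simp only [sum_fun_succ, sum_fun_zero]
  trans ∑ m, ∑ n, ∑ p, ∑ a, ∑ b, ∑ c, ∑ d,
    (epsZ ![m, n, p, a, b, c, d] : ℝ) * (phiZ m n p * H a b c d)
  · refine Finset.sum_congr rfl fun m _ => Finset.sum_congr rfl fun n _ =>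
      Finset.sum_congr rfl fun p _ => Finset.sum_congr rfl fun a _ => Finset.sum_congr rfl fun b _ =>
      Finset.sum_congr rfl fun c _ => Finset.sum_congr rfl fun d _ => ?_
    rfl
  rw [e, Finset.mul_sum]
  simp only [Finset.mul_sum, ← mul_assoc, ← Finset.sum_mul, sum_epsZ_phiZ]

end

/-! ### Expansion of the model form, and the linear algebra of the torsion -/

section

set_option maxRecDepth 100000

/-- The coefficients of the elementary 3-form `eⁱ ∧ eʲ ∧ eᵏ`. -/
def elemZ (i j k a b c : Fin 7) : ℤ :=
  dZ a i * (dZ b j * dZ c k - dZ b k * dZ c j) - dZ a j * (dZ b i * dZ c k - dZ b k * dZ c i)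
    + dZ a k * (dZ b i * dZ c j - dZ b j * dZ c i)

theorem elem3_eq_sum (i j k : Fin 7) (u v w : R7) :
    elem3 i j k u v w = ∑ a, ∑ b, ∑ c, (elemZ i j k a b c : ℝ) * (u a * v b * w c) := by
  simp [elem3, elemZ, dZ, Matrix.det_fin_three, add_mul, sub_mul, mul_sub, Finset.sum_add_distrib,
    Finset.sum_sub_distrib]
  ring

theorem phiZ_eq : ∀ a b c, phiZ a b c = elemZ 0 1 2 a b c + elemZ 0 3 4 a b c + elemZ 0 5 6 a b c
    + elemZ 1 3 5 a b c - elemZ 1 4 6 a b c - elemZ 2 3 6 a b c - elemZ 2 4 5 a b c := by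
  decide +kernel

theorem phi0_eq_sum (u v w : R7) :
    phi0 u v w = ∑ a, ∑ b, ∑ c, (phiZ a b c : ℝ) * (u a * v b * w c) := by
  simp only [phi0, elem3_eq_sum, phiZ_eq, Int.cast_add, Int.cast_sub, add_mul, sub_mul,
    Finset.sum_add_distrib, Finset.sum_sub_distrib]


/-- Each row of `phiZ` has six nonzero entries. Writing them out keeps the linear systems of
`torsion_of_antisymm` short. -/
theorem sum_phiZ_mul (X : Fin 7 → Fin 7 → ℝ) (p : Fin 7) :
    ∑ b, ∑ c, (phiZ p b c : ℝ) * X b c =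
      ![X 1 2 - X 2 1 + X 3 4 - X 4 3 + X 5 6 - X 6 5, X 2 0 - X 0 2 + X 3 5 - X 5 3 - X 4 6 + X 6 4,
        X 0 1 - X 1 0 - X 3 6 + X 6 3 - X 4 5 + X 5 4, X 4 0 - X 0 4 + X 5 1 - X 1 5 - X 6 2 + X 2 6,
        X 0 3 - X 3 0 - X 6 1 + X 1 6 - X 5 2 + X 2 5, X 6 0 - X 0 6 + X 1 3 - X 3 1 - X 2 4 + X 4 2,
        X 0 5 - X 5 0 - X 1 4 + X 4 1 - X 2 3 + X 3 2] p := by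
  fin_cases p <;> simp [Fin.sum_univ_seven, phiZ] <;> ring


theorem phiZ_cyclic : ∀ a b c, phiZ b c a = phiZ a b c := by decide +kernel

theorem psiZ_eq (a b c d : Fin 7) : (psiZ a b c d : ℝ) =
    ∑ k, (phiZ a b k : ℝ) * phiZ c d k - dZ a c * dZ b d + dZ a d * dZ b c := by
  simp [psiZ]

/-- The Kronecker terms of `psiZ` pair two equal indices of an alternating tensor and drop out,
leaving two successive contractions with `phiZ`. -/
theorem sum_psiZ_mul_of_antisymm {n : Fin 7 → Fin 7 → Fin 7 → ℝ}
    (h₁ : ∀ a b c, n b a c = -n a b c) (h₂ : ∀ a b c, n a c b = -n a b c) (m : Fin 7) :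
    ∑ b, ∑ c, ∑ d, (psiZ m b c d : ℝ) * n b c d =
      ∑ b, ∑ k, (phiZ m b k : ℝ) * ∑ c, ∑ d, (phiZ k c d : ℝ) * n b c d := by
  have z₁ : ∀ a b, n a a b = 0 := fun a b => by linarith [h₁ a a b]
  have z₂ : ∀ a b, n a b a = 0 := fun a b => by rw [h₂, z₁, neg_zero]
  refine Finset.sum_congr rfl fun b _ => ?_
  simp only [psiZ_eq, add_mul, sub_mul, Finset.sum_add_distrib, Finset.sum_sub_distrib]
  have e₁ : ∑ c, ∑ d, (dZ m c : ℝ) * dZ b d * n b c d = 0 := by simp [dZ, z₂]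
  have e₂ : ∑ c, ∑ d, (dZ m d : ℝ) * dZ b c * n b c d = 0 := by simp [dZ, z₁]
  rw [e₁, e₂, sub_zero, add_zero]
  simp only [Finset.mul_sum, Finset.sum_mul]
  symm
  rw [Finset.sum_comm]
  refine Finset.sum_congr rfl fun c _ => ?_
  rw [Finset.sum_comm]
  refine Finset.sum_congr rfl fun d _ => Finset.sum_congr rfl fun k _ => ?_
  rw [phiZ_cyclic k c d, mul_assoc]

-- In `Λ³ = Λ³₁ ⊕ Λ³₇ ⊕ Λ³₂₇`, the 28 symmetric equations `hS` say that the parts in `Λ³₁ ⊕ Λ³₂₇`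
-- vanish. The seven equations `ht` then fix the remaining part. The factor is `48 = 2 · 24`, since
-- `ψ` contracted with itself in three indices is `24 δ`.
set_option maxHeartbeats 4000000 in
theorem torsion_of_antisymm {n : Fin 7 → Fin 7 → Fin 7 → ℝ}
    (h₁ : ∀ a b c, n b a c = -n a b c) (h₂ : ∀ a b c, n a c b = -n a b c)
    (hS : ∀ p q, ∑ b, ∑ c, (phiZ p b c : ℝ) * n q b c + ∑ b, ∑ c, (phiZ q b c : ℝ) * n p b c = 0)
    {t : Fin 7 → ℝ} (ht : ∀ m, 48 * t m = ∑ b, ∑ c, ∑ d, (psiZ m b c d : ℝ) * n b c d)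
    (a b c : Fin 7) : n a b c = 2 * ∑ m, (psiZ m a b c : ℝ) * t m := by
  have z₁ : ∀ a b, n a a b = 0 := fun a b => by linarith [h₁ a a b]
  have z₂ : ∀ a b, n a b b = 0 := fun a b => by linarith [h₂ a b b]
  -- The order conditions turn antisymmetry into terminating rewrite rules that sort indices.
  have k₁ : ∀ a b, b < a → ∀ c, n a b c = -n b a c := fun a b _ c => h₁ b a c
  have k₂ : ∀ b c, c < b → ∀ a, n a b c = -n a c b := fun b c _ a => h₂ a c b
  simp only [sum_psiZ_mul_of_antisymm h₁ h₂, sum_phiZ_mul] at ht hS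
  rw [← sub_eq_zero]
  refine eq_zero_of_antisymm₃ (A := fun a b c => n a b c - 2 * ∑ m, (psiZ m a b c : ℝ) * t m)
    ?_ ?_ ?_ a b c
  · intro a b c
    simp only [h₁ a b c, (psiZ_swap _ a b c).2.1, Int.cast_neg, neg_mul, Finset.sum_neg_distrib]
    ring
  · intro a b c
    simp only [h₂ a b c, (psiZ_swap _ a b c).2.2, Int.cast_neg, neg_mul, Finset.sum_neg_distrib]
    ring
  have t0 := ht 0
  have t1 := ht 1
  have t2 := ht 2
  have t3 := ht 3
  have t4 := ht 4
  have t5 := ht 5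
  have t6 := ht 6
  -- `hS` is symmetric in its arguments, so the 28 pairs `p ≤ q` suffice. With the seven instances
  -- of `ht` they are 35 linear equations for the 35 sorted components of `n`.
  have s00 := hS 0 0
  have s01 := hS 0 1
  have s02 := hS 0 2
  have s03 := hS 0 3
  have s04 := hS 0 4
  have s05 := hS 0 5
  have s06 := hS 0 6
  have s11 := hS 1 1
  have s12 := hS 1 2
  have s13 := hS 1 3
  have s14 := hS 1 4
  have s15 := hS 1 5
  have s16 := hS 1 6
  have s22 := hS 2 2
  have s23 := hS 2 3
  have s24 := hS 2 4
  have s25 := hS 2 5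
  have s26 := hS 2 6
  have s33 := hS 3 3
  have s34 := hS 3 4
  have s35 := hS 3 5
  have s36 := hS 3 6
  have s44 := hS 4 4
  have s45 := hS 4 5
  have s46 := hS 4 6
  have s55 := hS 5 5
  have s56 := hS 5 6
  have s66 := hS 6 6
  simp [z₁, z₂, k₁, k₂] at t0 t1 t2 t3 t4 t5 t6 s00 s01 s02 s03 s04
  simp [z₁, z₂, k₁, k₂] at s05 s06 s11 s12 s13 s14 s15 s16 s22 s23 s24 s25
  simp [z₁, z₂, k₁, k₂] at s26 s33 s34 s35 s36 s44 s45 s46 s55 s56 s66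
  clear ht hS h₁ h₂ z₁ z₂ k₁ k₂
  intro a b c hab hbc
  fin_cases a <;> fin_cases b <;> first | exact absurd hab (by decide) | skip
  all_goals fin_cases c <;> first | exact absurd hbc (by decide) | skip
  all_goals
    simp [Fin.sum_univ_seven, psiZ, phiZ, dZ]
    linarith

end

/-! ### Contraction identities for `φ₀` and `ψ₀` -/

section

set_option maxRecDepth 100000

theorem sum_psiZ_mul_phiZ₂₃ : ∀ m a c, ∑ b, ∑ l, psiZ m a b l * phiZ c b l = 4 * phiZ m a c := by
  decide +kernel

theorem sum_psiZ_mul_phiZ₁₂ : ∀ m l c, ∑ a, ∑ b, psiZ m a b l * phiZ a b c = 4 * phiZ m l c := by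
  decide +kernel

theorem sum_psiZ_mul_phiZ₁₃ : ∀ m b c, ∑ a, ∑ l, psiZ m a b l * phiZ a c l = 4 * phiZ m b c := by
  decide +kernel

theorem sum_phiZ_mul_phiZ : ∀ i j, ∑ a, ∑ b, phiZ i a b * phiZ j a b = 6 * dZ i j := by
  decide +kernel

/-- The left side is the imaginary part of the associator `(eₐ e_b)e_t - eₐ(e_b e_t)`; the Kronecker
symbols come from the real parts of the inner products. -/
theorem associator_phiZ : ∀ a b t c, ∑ k, phiZ a b k * phiZ k t c - dZ a b * dZ t c
    - (∑ k, phiZ b t k * phiZ a k c - dZ a c * dZ b t) = 2 * psiZ t a b c := by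
  decide +kernel

end

/-! ### The standard octonions: associator, derivation defect, Ricci contraction -/

section

theorem sum_rotate₃ {α : Type*} [Fintype α] (F : α → α → α → ℝ) :
    ∑ a, ∑ b, ∑ c, F a b c = ∑ c, ∑ a, ∑ b, F a b c := by
  trans ∑ a, ∑ c, ∑ b, F a b c
  · exact Finset.sum_congr rfl fun a _ => Finset.sum_comm
  · exact Finset.sum_comm

theorem sum_reverse₄ {α : Type*} [Fintype α] (F : α → α → α → α → ℝ) :
    ∑ k, ∑ m, ∑ a, ∑ b, F k m a b = ∑ a, ∑ b, ∑ m, ∑ k, F k m a b := by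
  trans ∑ a, ∑ b, ∑ k, ∑ m, F k m a b
  · have := Finset.sum_comm (s := (Finset.univ : Finset (α × α)))
      (t := (Finset.univ : Finset (α × α))) (f := fun x y => F x.1 x.2 y.1 y.2)
    simpa only [Fintype.sum_prod_type] using this
  · exact Finset.sum_congr rfl fun a _ => Finset.sum_congr rfl fun b _ => Finset.sum_comm

/-- This is the model case of `g vol = (1/6)(u ⌟ φ) ∧ (v ⌟ φ) ∧ φ`: the value `144 = 6 · 4 · 6`
cancels the factor `(1/6)(1/24)` in `B`. -/
theorem sum_perm_phiZ_mul_phiZ_mul_phiZ (i j : Fin 7) :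
    ∑ σ : Equiv.Perm (Fin 7), ((Equiv.Perm.sign σ : ℤ) : ℝ) * ((phiZ i (σ 0) (σ 1) : ℝ) *
      phiZ j (σ 2) (σ 3) * phiZ (σ 4) (σ 5) (σ 6)) = 144 * dZ i j := by
  have hr : Equiv.Perm.sign (Equiv.addRight (3 : Fin 7)) = 1 := by decide +kernel
  -- Translation by 3 is a 7-cycle, hence even. It moves the last three slots to the front, where
  -- `sum_perm_phiZ` expects the factor `φ₀`.
  rw [← Equiv.sum_comp (Equiv.mulRight (Equiv.addRight (3 : Fin 7)))]
  have h := sum_perm_phiZ fun a b c d => (phiZ i a b : ℝ) * phiZ j c d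
  have e : ∑ a, ∑ b, ∑ c, ∑ d, (psiZ a b c d : ℝ) * ((phiZ i a b : ℝ) * phiZ j c d)
      = 24 * dZ i j := by
    have k₁ : ∀ m a c, ∑ b, ∑ l, (psiZ m a b l : ℝ) * phiZ c b l = 4 * phiZ m a c := by
      exact_mod_cast sum_psiZ_mul_phiZ₂₃
    have k₂ : ∀ i j, ∑ a, ∑ b, (phiZ i a b : ℝ) * phiZ j a b = 6 * dZ i j := by
      exact_mod_cast sum_phiZ_mul_phiZ
    have : ∀ a b, ∑ c, ∑ d, (psiZ a b c d : ℝ) * ((phiZ i a b : ℝ) * phiZ j c d)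
        = 4 * ((phiZ i a b : ℝ) * phiZ j a b) := by
      intro a b
      simp only [mul_left_comm _ (phiZ i a b : ℝ), ← Finset.mul_sum, k₁, phiZ_cyclic j a b]
    simp only [this, ← Finset.mul_sum, k₂]
    ring
  rw [e] at h
  rw [show (144 : ℝ) * dZ i j = 6 * (24 * dZ i j) by ring, ← h]
  refine Finset.sum_congr rfl fun σ _ => ?_
  simp only [Equiv.coe_mulRight, Equiv.Perm.sign_mul, hr, mul_one, Equiv.Perm.mul_apply,
    Equiv.coe_addRight]
  rw [mul_comm (_ * _ : ℝ) (phiZ _ _ _ : ℝ)]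
  congr 2

/-- The cross product of `ℝ⁷` given by `phi0`. -/
def cross0 (u v : Fin 7 → ℝ) : Fin 7 → ℝ := fun c => ∑ a, ∑ b, (phiZ a b c : ℝ) * (u a * v b)

/-- The octonion product given by `phi0`. -/
def mul0 (A C : Oct) : Oct :=
  (A.1 * C.1 - A.2 ⬝ᵥ C.2, A.1 • C.2 + C.1 • A.2 + cross0 A.2 C.2)

theorem cross0_add_left (u v w : Fin 7 → ℝ) : cross0 (u + v) w = cross0 u w + cross0 v w := by
  ext c; simp [cross0, add_mul, mul_add, Finset.sum_add_distrib]

theorem cross0_add_right (u v w : Fin 7 → ℝ) : cross0 u (v + w) = cross0 u v + cross0 u w := by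
  ext c; simp [cross0, mul_add, Finset.sum_add_distrib]

theorem cross0_smul_left (x : ℝ) (u v : Fin 7 → ℝ) : cross0 (x • u) v = x • cross0 u v := by
  ext c
  simp only [cross0, Pi.smul_apply, smul_eq_mul, Finset.mul_sum]
  exact Finset.sum_congr rfl fun a _ => Finset.sum_congr rfl fun b _ => by ring

theorem cross0_smul_right (x : ℝ) (u v : Fin 7 → ℝ) : cross0 u (x • v) = x • cross0 u v := by
  ext c
  simp only [cross0, Pi.smul_apply, smul_eq_mul, Finset.mul_sum]
  exact Finset.sum_congr rfl fun a _ => Finset.sum_congr rfl fun b _ => by ring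

theorem cross0_dotProduct (u v t : Fin 7 → ℝ) : cross0 u v ⬝ᵥ t = u ⬝ᵥ cross0 v t := by
  simp only [cross0, dotProduct, Finset.mul_sum, Finset.sum_mul]
  rw [← sum_rotate₃ (fun a b c => (phiZ a b c : ℝ) * (u a * v b) * t c)]
  refine Finset.sum_congr rfl fun a _ => Finset.sum_congr rfl fun b _ =>
    Finset.sum_congr rfl fun c _ => ?_
  rw [phiZ_cyclic a b c]
  ring

theorem cross0_assoc (u v t : Fin 7 → ℝ) (l : Fin 7) :
    cross0 (cross0 u v) t l - (u ⬝ᵥ v) * t l - (cross0 u (cross0 v t) l - (v ⬝ᵥ t) * u l) =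
      ∑ a, ∑ b, (2 * ∑ m, (psiZ m a b l : ℝ) * t m) * (u a * v b) := by
  have k : ∀ a b t c, ∑ k, (phiZ a b k : ℝ) * phiZ k t c - dZ a b * dZ t c
    - (∑ k, (phiZ b t k : ℝ) * phiZ a k c - dZ a c * dZ b t) = 2 * psiZ t a b c := by
    exact_mod_cast associator_phiZ
  have e : ∀ a b, (2 * ∑ m, (psiZ m a b l : ℝ) * t m) * (u a * v b) =
      ∑ m, (∑ k, (phiZ a b k : ℝ) * phiZ k m l) * (u a * v b * t m)
        - ∑ m, (dZ a b * dZ m l : ℝ) * (u a * v b * t m)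
        - (∑ m, (∑ k, (phiZ b m k : ℝ) * phiZ a k l) * (u a * v b * t m)
        - ∑ m, (dZ a l * dZ b m : ℝ) * (u a * v b * t m)) := by
    intro a b
    simp only [← Finset.sum_sub_distrib]
    rw [Finset.mul_sum, Finset.sum_mul]
    refine Finset.sum_congr rfl fun m _ => ?_
    linear_combination (-(u a * v b * t m)) * k a b m l
  simp only [e, Finset.sum_sub_distrib]
  congr 1
  · congr 1
    · simp only [cross0, Finset.mul_sum, Finset.sum_mul]
      rw [sum_reverse₄]
      refine Finset.sum_congr rfl fun a _ => Finset.sum_congr rfl fun b _ =>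
        Finset.sum_congr rfl fun m _ => Finset.sum_congr rfl fun k _ => by ring
    · simp [dZ, dotProduct, Finset.sum_mul]
  · congr 1
    · simp only [cross0, Finset.mul_sum, Finset.sum_mul]
      refine Finset.sum_congr rfl fun a _ => ?_
      rw [← sum_rotate₃]
      refine Finset.sum_congr rfl fun b _ =>
        Finset.sum_congr rfl fun m _ => Finset.sum_congr rfl fun k _ => by ring
    · simp only [dZ, dotProduct, Finset.sum_mul]
      simp
      exact Finset.sum_congr rfl fun m _ => by ring

/-- An associator with a real argument vanishes, so only imaginary parts enter. Its real part
vanishes because `⟨u × v, t⟩ = ⟨u, v × t⟩`. -/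
theorem mul0_assoc (A C B : Oct) :
    mul0 (mul0 A C) B - mul0 A (mul0 C B) =
      (0, fun c => ∑ a, ∑ b, (2 * ∑ m, (psiZ m a b c : ℝ) * B.2 m) * (A.2 a * C.2 b)) := by
  obtain ⟨x, u⟩ := A
  obtain ⟨z, v⟩ := C
  obtain ⟨r, t⟩ := B
  ext l
  · simp [mul0, cross0_dotProduct, add_dotProduct, dotProduct_add]
    ring
  · simp only [← cross0_assoc]
    simp [mul0, cross0_add_left, cross0_add_right, cross0_smul_left, cross0_smul_right]
    ring

theorem sum_exchange₄ {α : Type*} [Fintype α] (F : α → α → α → α → ℝ) :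
    ∑ a, ∑ b, ∑ l, ∑ c, F a b l c = ∑ l, ∑ c, ∑ a, ∑ b, F a b l c := by
  rw [sum_reverse₄]
  exact Finset.sum_congr rfl fun a _ => Finset.sum_congr rfl fun b _ => Finset.sum_comm

/-- Both sides are contracted with `psiZ m a b l`. The right side becomes `48 q`. Each of the three
terms on the left gives `4 φ · ρ` after its sign and the skewness of `ρ` are used, whence `12/48 =
1/4`. -/
theorem eq_of_derivation_defect {ρ : Fin 7 → Fin 7 → ℝ} {q : Fin 7 → ℝ}
    (hρ : ∀ c d, ρ c d = -ρ d c)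
    (H : ∀ a b l, ∑ c, (phiZ a b c : ℝ) * ρ l c - ∑ c, ρ c a * phiZ c b l -
      ∑ c, ρ c b * phiZ a c l = 2 * ∑ m, (psiZ m a b l : ℝ) * q m) (m : Fin 7) :
    q m = 1 / 4 * ∑ c, ∑ d, (phiZ m c d : ℝ) * ρ c d := by
  have k₁ : ∀ m a c, ∑ b, ∑ l, (psiZ m a b l : ℝ) * phiZ c b l = 4 * phiZ m a c := by
    exact_mod_cast sum_psiZ_mul_phiZ₂₃
  have k₂ : ∀ m l c, ∑ a, ∑ b, (psiZ m a b l : ℝ) * phiZ a b c = 4 * phiZ m l c := by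
    exact_mod_cast sum_psiZ_mul_phiZ₁₂
  have k₃ : ∀ m b c, ∑ a, ∑ l, (psiZ m a b l : ℝ) * phiZ a c l = 4 * phiZ m b c := by
    exact_mod_cast sum_psiZ_mul_phiZ₁₃
  have k₅ : ∀ i j, ∑ a, ∑ b, (phiZ i a b : ℝ) * phiZ j a b = 6 * dZ i j := by
    exact_mod_cast sum_phiZ_mul_phiZ
  -- One factor `ψ` is unfolded: its Kronecker terms meet the other, alternating `ψ` and vanish, so
  -- `ψψ` becomes `4 φφ = 4 · 6 δ`.
  have k₄ : ∀ m e, ∑ a, ∑ b, ∑ l, (psiZ m a b l : ℝ) * psiZ e a b l = 24 * dZ m e := by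
    intro m e
    have z₁ : ∀ a b, psiZ m a b a = 0 := fun a b => by
      have h₁ := (psiZ_swap m a b a).2.2
      have h₂ := (psiZ_swap m a a b).2.1
      omega
    have z₂ : ∀ a b, psiZ m a a b = 0 := fun a b => by
      have h₂ := (psiZ_swap m a a b).2.1
      omega
    have h : ∀ a, ∑ b, ∑ l, (psiZ m a b l : ℝ) * psiZ e a b l =
        4 * ∑ k, (phiZ m a k : ℝ) * phiZ e a k := by
      intro a
      have d₁ : ∑ b, ∑ l, (psiZ m a b l : ℝ) * (dZ e b * dZ a l) = 0 := by simp [dZ, z₁]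
      have d₂ : ∑ b, ∑ l, (psiZ m a b l : ℝ) * (dZ e l * dZ a b) = 0 := by simp [dZ, z₂]
      simp only [psiZ_eq e, mul_add, mul_sub, Finset.sum_add_distrib, Finset.sum_sub_distrib, d₁, d₂,
        sub_zero, add_zero]
      simp only [Finset.mul_sum]
      rw [sum_rotate₃]
      refine Finset.sum_congr rfl fun k _ => ?_
      simp only [mul_left_comm _ (phiZ e a k : ℝ), ← Finset.mul_sum]
      simp only [phiZ_cyclic k _ _, k₁]
      ring
    simp only [h, ← Finset.mul_sum, k₅]
    simp only [dZ]
    push_cast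
    simp
    ring_nf
  have e₀ : ∑ a, ∑ b, ∑ l, (psiZ m a b l : ℝ) * (2 * ∑ e, (psiZ e a b l : ℝ) * q e)
      = 48 * q m := by
    trans ∑ e, (∑ a, ∑ b, ∑ l, (psiZ m a b l : ℝ) * psiZ e a b l) * (2 * q e)
    · simp only [Finset.mul_sum, Finset.sum_mul]
      rw [← sum_rotate₃ (fun a b e => ∑ l, (psiZ m a b l : ℝ) * psiZ e a b l * (2 * q e))]
      refine Finset.sum_congr rfl fun a _ => Finset.sum_congr rfl fun b _ => ?_
      rw [Finset.sum_comm]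
      exact Finset.sum_congr rfl fun e _ => Finset.sum_congr rfl fun l _ => by ring
    · simp [k₄, dZ]
      ring
  have e₁ : ∑ a, ∑ b, ∑ l, (psiZ m a b l : ℝ) * ∑ c, (phiZ a b c : ℝ) * ρ l c =
      4 * ∑ c, ∑ d, (phiZ m c d : ℝ) * ρ c d := by
    simp only [Finset.mul_sum]
    rw [sum_exchange₄]
    refine Finset.sum_congr rfl fun l _ => Finset.sum_congr rfl fun c _ => ?_
    simp only [← mul_assoc, ← Finset.sum_mul, k₂]
  have e₂ : ∑ a, ∑ b, ∑ l, (psiZ m a b l : ℝ) * ∑ c, ρ c a * phiZ c b l =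
      -(4 * ∑ c, ∑ d, (phiZ m c d : ℝ) * ρ c d) := by
    simp only [Finset.mul_sum, ← Finset.sum_neg_distrib]
    refine Finset.sum_congr rfl fun a _ => ?_
    rw [sum_rotate₃]
    refine Finset.sum_congr rfl fun c _ => ?_
    simp only [mul_left_comm _ (ρ c a), ← Finset.mul_sum, k₁]
    rw [hρ c a]
    ring
  have e₃ : ∑ a, ∑ b, ∑ l, (psiZ m a b l : ℝ) * ∑ c, ρ c b * phiZ a c l =
      -(4 * ∑ c, ∑ d, (phiZ m c d : ℝ) * ρ c d) := by
    rw [Finset.sum_comm]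
    simp only [Finset.mul_sum, ← Finset.sum_neg_distrib]
    refine Finset.sum_congr rfl fun a _ => ?_
    rw [sum_rotate₃]
    refine Finset.sum_congr rfl fun c _ => ?_
    simp only [mul_left_comm _ (ρ c a), ← Finset.mul_sum, k₃]
    rw [hρ c a]
    ring
  simp only [← H, mul_sub, Finset.sum_sub_distrib, e₁, e₂, e₃] at e₀
  linarith

/-- Rotating the summation indices replaces `w` by its cyclic average, which is zero. It is applied
with `w` the curvature, so that `φ` and `ψ` annihilate it by the Bianchi identity. -/
theorem sum_cyclic_eq_zero {P w : Fin 7 → Fin 7 → Fin 7 → ℝ} (hP : ∀ a c d, P c d a = P a c d)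
    (hw : ∀ a c d, w a c d + w c d a + w d a c = 0) : ∑ a, ∑ c, ∑ d, P a c d * w a c d = 0 := by
  have h₁ : ∑ a, ∑ c, ∑ d, P a c d * w c d a = ∑ a, ∑ c, ∑ d, P a c d * w a c d := by
    rw [sum_rotate₃ (fun a c d => P a c d * w a c d)]
    exact Finset.sum_congr rfl fun a _ => Finset.sum_congr rfl fun b _ =>
      Finset.sum_congr rfl fun c _ => by rw [hP a b c]
  have h₂ : ∑ a, ∑ c, ∑ d, P a c d * w d a c = ∑ a, ∑ c, ∑ d, P a c d * w a c d := by
    rw [sum_rotate₃ (fun a c d => P a c d * w d a c)]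
    exact Finset.sum_congr rfl fun a _ => Finset.sum_congr rfl fun b _ =>
      Finset.sum_congr rfl fun c _ => by rw [hP]
  have h : ∑ a, ∑ c, ∑ d, P a c d * (w a c d + w c d a + w d a c) = 0 := by simp [hw]
  simp only [mul_add, Finset.sum_add_distrib, h₁, h₂] at h
  linarith

/-- The real part is `φ · w`, which the cyclic identity kills. In the imaginary part `φφ = ψ + δδ -
δδ`, the `ψ` term vanishes likewise, and by skewness the two Kronecker terms both give `-∑ w a a l`.
Then `-(1/4)(-2) = 1/2`. -/
theorem sum_mul0_eq_ricci {w : Fin 7 → Fin 7 → Fin 7 → ℝ} (hw : ∀ a c d, w a c d = -w a d c)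
    (hB : ∀ a c d, w a c d + w c d a + w d a c = 0) :
    -∑ a, mul0 (0, Pi.single a 1) (0, fun m => 1 / 4 * ∑ c, ∑ d, (phiZ m c d : ℝ) * w a c d) =
      (1 / 2 : ℝ) • ((0, fun l => ∑ a, w a a l) : Oct) := by
  have e : ∀ (a : Fin 7) (x : Fin 7 → ℝ), mul0 (0, Pi.single a 1) (0, x) =
      (-x a, fun l => ∑ m, (phiZ a m l : ℝ) * x m) := by
    intro a x
    ext l <;> simp [mul0, cross0, Pi.single_apply]
  simp only [e]
  ext l
  · simp only [Prod.fst_neg, Prod.fst_sum, Prod.smul_fst, smul_zero, Finset.sum_neg_distrib,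
      ← Finset.mul_sum, neg_neg]
    rw [sum_cyclic_eq_zero (P := fun a c d => (phiZ a c d : ℝ)) (by simp [phiZ_cyclic]) hB,
      mul_zero]
  · have k : ∀ a c d, ∑ m, (phiZ a m l : ℝ) * phiZ m c d =
        psiZ l a c d + dZ l c * dZ a d - dZ l d * dZ a c := by
      intro a c d
      simp only [psiZ_eq, phiZ_cyclic l a, phiZ_cyclic _ c d]
      ring
    have h : ∑ a, ∑ c, ∑ d, (psiZ l a c d : ℝ) * w a c d = 0 :=
      sum_cyclic_eq_zero (P := fun a c d => (psiZ l a c d : ℝ)) (fun a c d => by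
        rw [(psiZ_swap l c a d).2.2, (psiZ_swap l a c d).2.1, neg_neg]) hB
    have h' : ∑ a, ∑ m, (phiZ a m l : ℝ) * (∑ c, ∑ d, (phiZ m c d : ℝ) * w a c d) =
        -(2 * ∑ a, w a a l) := by
      trans ∑ a, ∑ c, ∑ d, (∑ m, (phiZ a m l : ℝ) * phiZ m c d) * w a c d
      · refine Finset.sum_congr rfl fun a _ => ?_
        simp only [Finset.mul_sum, Finset.sum_mul]
        rw [← sum_rotate₃]
        simp only [mul_assoc]
      · simp only [k, add_mul, sub_mul, Finset.sum_add_distrib, Finset.sum_sub_distrib, h]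
        simp [dZ, hw _ l _]
        ring
    simp only [Prod.snd_neg, Prod.snd_sum, Prod.smul_snd, Pi.neg_apply, Finset.sum_apply,
      Pi.smul_apply, smul_eq_mul, mul_left_comm _ (1 / 4 : ℝ), ← Finset.mul_sum, h']
    ring

end

/-! ### Pointwise frames: metric and volume form -/

section

set_option maxRecDepth 100000

/-- The value `φ₀(u, v, w)` in terms of structure constants, on `Fin 7 → ℝ`. -/
def triple (u v w : Fin 7 → ℝ) : ℝ := ∑ a, ∑ b, ∑ c, (phiZ a b c : ℝ) * (u a * v b * w c)

theorem triple_add₁ (u u' v w) : triple (u + u') v w = triple u v w + triple u' v w := by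
  simp only [triple, ← Finset.sum_add_distrib, Pi.add_apply]
  exact Finset.sum_congr rfl fun a _ => Finset.sum_congr rfl fun b _ =>
    Finset.sum_congr rfl fun c _ => by ring

theorem triple_add₂ (u v v' w) : triple u (v + v') w = triple u v w + triple u v' w := by
  simp only [triple, ← Finset.sum_add_distrib, Pi.add_apply]
  exact Finset.sum_congr rfl fun a _ => Finset.sum_congr rfl fun b _ =>
    Finset.sum_congr rfl fun c _ => by ring

theorem triple_add₃ (u v w w') : triple u v (w + w') = triple u v w + triple u v w' := by
  simp only [triple, ← Finset.sum_add_distrib, Pi.add_apply]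
  exact Finset.sum_congr rfl fun a _ => Finset.sum_congr rfl fun b _ =>
    Finset.sum_congr rfl fun c _ => by ring

theorem triple_smul₁ (x : ℝ) (u v w) : triple (x • u) v w = x * triple u v w := by
  simp only [triple, Finset.mul_sum, Pi.smul_apply, smul_eq_mul]
  exact Finset.sum_congr rfl fun a _ => Finset.sum_congr rfl fun b _ =>
    Finset.sum_congr rfl fun c _ => by ring

theorem triple_smul₂ (x : ℝ) (u v w) : triple u (x • v) w = x * triple u v w := by
  simp only [triple, Finset.mul_sum, Pi.smul_apply, smul_eq_mul]
  exact Finset.sum_congr rfl fun a _ => Finset.sum_congr rfl fun b _ =>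
    Finset.sum_congr rfl fun c _ => by ring

theorem triple_smul₃ (x : ℝ) (u v w) : triple u v (x • w) = x * triple u v w := by
  simp only [triple, Finset.mul_sum, Pi.smul_apply, smul_eq_mul]
  exact Finset.sum_congr rfl fun a _ => Finset.sum_congr rfl fun b _ =>
    Finset.sum_congr rfl fun c _ => by ring

/-- The multilinear map `(u ⌟ φ₀) ⊗ (w ⌟ φ₀) ⊗ φ₀`. -/
def contraction (u w : Fin 7 → ℝ) : MultilinearMap ℝ (fun _ : Fin 7 => Fin 7 → ℝ) ℝ :=
  MultilinearMap.mk' (fun v => triple u (v 0) (v 1) * triple w (v 2) (v 3) *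
    triple (v 4) (v 5) (v 6))
  (by
    intro v i x y
    fin_cases i <;> simp [Function.update, triple_add₁, triple_add₂, triple_add₃] <;> ring)
  (by
    intro v i c x
    fin_cases i <;> simp [Function.update, triple_smul₁, triple_smul₂, triple_smul₃] <;> ring)

theorem contraction_apply (u w : Fin 7 → ℝ) (v : Fin 7 → Fin 7 → ℝ) : contraction u w v =
    triple u (v 0) (v 1) * triple w (v 2) (v 3) * triple (v 4) (v 5) (v 6) := rfl

/-- An alternating 7-linear form on `ℝ⁷` is its value on the standard basis times the determinant.
The value on the basis is the model computation `sum_perm_phiZ_mul_phiZ_mul_phiZ`. -/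
theorem sum_perm_contraction (u w : Fin 7 → ℝ) (L : Matrix (Fin 7) (Fin 7) ℝ) :
    ∑ σ : Equiv.Perm (Fin 7), ((Equiv.Perm.sign σ : ℤ) : ℝ) *
      contraction u w (fun i a => L a (σ i)) = 144 * L.det * (u ⬝ᵥ w) := by
  have h := congrArg (fun f => f (fun i a => L a i))
    ((contraction u w).alternatization.eq_smul_basis_det (Pi.basisFun ℝ (Fin 7)))
  have hb : ∀ b c, triple u (Pi.single b 1) (Pi.single c 1) = ∑ a, (phiZ a b c : ℝ) * u a := by
    intro b c
    simp [triple, Pi.single_apply]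
  have hb' : ∀ b c, triple w (Pi.single b 1) (Pi.single c 1) = ∑ a, (phiZ a b c : ℝ) * w a := by
    intro b c
    simp [triple, Pi.single_apply]
  have hc : ∀ a b c, triple (Pi.single a 1) (Pi.single b 1) (Pi.single c 1) = phiZ a b c := by
    intro a b c
    simp [triple, Pi.single_apply]
  have hdet : Matrix.detRowAlternating (fun i a => L a i) = L.det := Matrix.det_transpose L
  simp only [AlternatingMap.smul_apply, MultilinearMap.alternatization_apply,
    Pi.basisFun_det, hdet, smul_eq_mul, MultilinearMap.domDomCongr_apply] at h
  have h₁ : ∀ (σ : Equiv.Perm (Fin 7)) (x : ℝ), Equiv.Perm.sign σ • x =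
    ((Equiv.Perm.sign σ : ℤ) : ℝ) * x := fun σ x => by
      rw [Units.smul_def, zsmul_eq_mul]
  simp only [h₁] at h
  rw [h]
  have h₂ : ∀ σ : Equiv.Perm (Fin 7), ((Equiv.Perm.sign σ : ℤ) : ℝ) *
      contraction u w (fun i => Pi.basisFun ℝ (Fin 7) (σ i)) = ∑ a, ∑ b, (u a * w b) *
        (((Equiv.Perm.sign σ : ℤ) : ℝ) * ((phiZ a (σ 0) (σ 1) : ℝ) *
      phiZ b (σ 2) (σ 3) * phiZ (σ 4) (σ 5) (σ 6))) := by
    intro σ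
    simp only [contraction_apply, Pi.basisFun_apply, hb, hb', hc,
      Finset.mul_sum, Finset.sum_mul]
    rw [Finset.sum_comm]
    exact Finset.sum_congr rfl fun a _ => Finset.sum_congr rfl fun b _ => by ring
  simp only [h₂]
  have h₃ : ∀ F : Equiv.Perm (Fin 7) → Fin 7 → Fin 7 → ℝ,
      ∑ σ, ∑ a, ∑ b, F σ a b = ∑ a, ∑ b, ∑ σ, F σ a b := by
    intro F
    rw [Finset.sum_comm]
    exact Finset.sum_congr rfl fun a _ => Finset.sum_comm
  rw [h₃]
  simp only [← Finset.mul_sum, sum_perm_phiZ_mul_phiZ_mul_phiZ]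
  simp [dZ, dotProduct, Finset.mul_sum, Finset.sum_mul]
  exact Finset.sum_congr rfl fun a _ => by ring

/-- The 3-form `φ` is at `y` the pull-back of `phi0` by the matrix `L`. -/
def IsFrame (φ : Form3) (y : R7) (L : Matrix (Fin 7) (Fin 7) ℝ) : Prop :=
  IsUnit L.det ∧ ∀ i j k, φ y i j k = triple (L.col i) (L.col j) (L.col k)

section Frame

variable {φ : Form3} {y : R7} {L : Matrix (Fin 7) (Fin 7) ℝ}

theorem IsFrame.B_eq (h : IsFrame φ y L) : B φ y = L.det • (Lᵀ * L) := by
  ext i j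
  have := sum_perm_contraction (L.col i) (L.col j) L
  simp only [B, Matrix.of_apply, h.2]
  rw [← mul_assoc]
  change _ * ∑ σ : Equiv.Perm (Fin 7), ((Equiv.Perm.sign σ : ℤ) : ℝ) *
      contraction (L.col i) (L.col j) (fun i a => L a (σ i)) = _
  rw [this]
  simp [Matrix.mul_apply, dotProduct]
  ring

theorem IsFrame.vol_eq (h : IsFrame φ y L) : vol φ y = L.det := by
  -- Scaling a 7×7 matrix by `L.det` contributes the seventh power, and `Lᵀ * L` the square. As nine
  -- is odd, the signed root recovers `L.det` with its sign.
  have hd : (B φ y).det = L.det ^ 9 := by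
    rw [h.B_eq, Matrix.det_smul, Matrix.det_mul, Matrix.det_transpose]
    simp
    ring
  have hp : (|L.det| ^ 9) ^ (1 / 9 : ℝ) = |L.det| := by
    rw [← Real.rpow_natCast, ← Real.rpow_mul (abs_nonneg _)]
    norm_num
  have hs : SignType.sign (L.det ^ 9) = SignType.sign L.det := by
    rw [sign_pow]
    rcases SignType.sign L.det with _ | _ | _ <;> rfl
  rw [vol, hd, abs_pow, hp, hs, sign_mul_abs]

theorem IsFrame.g_eq (h : IsFrame φ y L) : g φ y = Lᵀ * L := by
  ext i j
  have := h.1.ne_zero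
  simp only [g, Matrix.of_apply, h.B_eq, h.vol_eq, Matrix.smul_apply, smul_eq_mul]
  field_simp

theorem IsFrame.gInv_eq (h : IsFrame φ y L) : gInv φ y = L⁻¹ * L⁻¹ᵀ := by
  rw [gInv, h.g_eq, Matrix.mul_inv_rev, Matrix.transpose_nonsing_inv]

end Frame

end

/-! ### Dual form, torsion and octonion product in a frame -/

section

set_option maxRecDepth 100000

/-- Indices of a sum of pure tensors can be raised factor by factor. The index type `ι` is left
free: it is a set of index triples for `φ`, and the permutation group for the Leibniz expansion. -/
theorem sum_contract₃ {ι α : Type*} [Fintype ι] [Fintype α] (A B C : α → ℝ) (c : ι → ℝ)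
    (X Y Z : ι → α → ℝ) :
    ∑ m, ∑ n, ∑ p, A m * B n * C p * ∑ x, c x * (X x m * Y x n * Z x p) =
      ∑ x, c x * ((∑ m, A m * X x m) * (∑ n, B n * Y x n) * (∑ p, C p * Z x p)) := by
  trans ∑ x, ∑ m, ∑ n, ∑ p, A m * B n * C p * (c x * (X x m * Y x n * Z x p))
  · symm
    simp only [Finset.mul_sum]
    rw [Finset.sum_comm]
    refine Finset.sum_congr rfl fun m _ => ?_
    rw [Finset.sum_comm]
    refine Finset.sum_congr rfl fun n _ => ?_
    rw [Finset.sum_comm]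
  · refine Finset.sum_congr rfl fun x _ => ?_
    rw [Finset.sum_mul_sum, Finset.sum_mul, Finset.mul_sum]
    refine Finset.sum_congr rfl fun m _ => ?_
    rw [Finset.sum_mul, Finset.mul_sum]
    refine Finset.sum_congr rfl fun n _ => ?_
    rw [Finset.mul_sum, Finset.mul_sum]
    exact Finset.sum_congr rfl fun p _ => by ring

theorem sum_contract₄ {ι α : Type*} [Fintype ι] [Fintype α] (A B C D : α → ℝ) (c : ι → ℝ)
    (X Y Z W : ι → α → ℝ) :
    ∑ m, ∑ n, ∑ p, ∑ q, A m * B n * C p * D q * ∑ x, c x * (X x m * Y x n * Z x p * W x q) =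
      ∑ x, c x * ((∑ m, A m * X x m) * (∑ n, B n * Y x n) * (∑ p, C p * Z x p) *
        (∑ q, D q * W x q)) := by
  trans ∑ x, ∑ m, ∑ n, ∑ p, ∑ q, A m * B n * C p * D q *
    (c x * (X x m * Y x n * Z x p * W x q))
  · symm
    simp only [Finset.mul_sum]
    rw [Finset.sum_comm]
    refine Finset.sum_congr rfl fun m _ => ?_
    rw [Finset.sum_comm]
    refine Finset.sum_congr rfl fun n _ => ?_
    rw [Finset.sum_comm]
    refine Finset.sum_congr rfl fun p _ => ?_
    rw [Finset.sum_comm]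
  · refine Finset.sum_congr rfl fun x _ => ?_
    rw [Finset.sum_mul_sum, Finset.sum_mul, Finset.sum_mul, Finset.mul_sum]
    refine Finset.sum_congr rfl fun m _ => ?_
    rw [Finset.sum_mul, Finset.sum_mul, Finset.mul_sum]
    refine Finset.sum_congr rfl fun n _ => ?_
    rw [Finset.mul_sum _ (fun p => C p * Z x p), Finset.sum_mul, Finset.mul_sum]
    refine Finset.sum_congr rfl fun p _ => ?_
    rw [Finset.mul_sum, Finset.mul_sum]
    exact Finset.sum_congr rfl fun q _ => by ring

variable {φ : Form3} {y : R7} {L : Matrix (Fin 7) (Fin 7) ℝ}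

theorem sum_gInv_mul (h : IsFrame φ y L) (m x : Fin 7) : ∑ l, gInv φ y m l * L x l = L⁻¹ m x := by
  have : gInv φ y * Lᵀ = L⁻¹ := by
    rw [h.gInv_eq, Matrix.mul_assoc, ← Matrix.transpose_mul, Matrix.mul_nonsing_inv _ h.1,
      Matrix.transpose_one, Matrix.mul_one]
  simpa [Matrix.mul_apply] using congrFun (congrFun this m) x

theorem sum_inv_mul (h : IsFrame φ y L) (a x : Fin 7) :
    ∑ m, L⁻¹ m x * L a m = if a = x then 1 else 0 := by
  have := congrFun (congrFun (Matrix.mul_nonsing_inv L h.1) a) x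
  simpa [Matrix.mul_apply, mul_comm, Matrix.one_apply] using this

theorem triple_eq_sum_prod (u v w : Fin 7 → ℝ) : triple u v w =
    ∑ x : Fin 7 × Fin 7 × Fin 7, (phiZ x.1 x.2.1 x.2.2 : ℝ) * (u x.1 * v x.2.1 * w x.2.2) := by
  simp only [triple, Fintype.sum_prod_type]

theorem sum_gInv_phi (h : IsFrame φ y L) (m n p : Fin 7) :
    ∑ m', ∑ n', ∑ p', gInv φ y m m' * gInv φ y n n' * gInv φ y p p' * φ y m' n' p' =
      triple (L⁻¹ m) (L⁻¹ n) (L⁻¹ p) := by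
  simp only [h.2, triple_eq_sum_prod, Matrix.col_apply]
  rw [sum_contract₃ (gInv φ y m) (gInv φ y n) (gInv φ y p)
    (fun x : Fin 7 × Fin 7 × Fin 7 => (phiZ x.1 x.2.1 x.2.2 : ℝ))
    (fun x a => L x.1 a) (fun x a => L x.2.1 a) (fun x a => L x.2.2 a)]
  simp only [sum_gInv_mul h]

/-- Both sides are the determinant of the matrix formed from the columns `s i` of `L`. -/
theorem vol_mul_eps (h : IsFrame φ y L) (s : Fin 7 → Fin 7) : vol φ y * eps s =
    ∑ σ : Equiv.Perm (Fin 7), ((Equiv.Perm.sign σ : ℤ) : ℝ) * ∏ i, L (σ i) (s i) := by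
  have : L.submatrix id s = L * (1 : Matrix (Fin 7) (Fin 7) ℝ).submatrix id s := by
    ext i j
    simp [Matrix.mul_apply, Matrix.one_apply]
  have ht : eps s = ((1 : Matrix (Fin 7) (Fin 7) ℝ).submatrix id s).det := by
    rw [eps, ← Matrix.det_transpose, Matrix.transpose_submatrix, Matrix.transpose_one]
  rw [h.vol_eq, ht, ← Matrix.det_mul, ← this, Matrix.det_apply']
  rfl

/-- Raising the indices of `φ` puts `L⁻¹` in its three slots. These cancel the first three factors
of the Leibniz expansion, leaving only model constants and four entries of `L`. -/
theorem psi_eq (h : IsFrame φ y L) (a b c d : Fin 7) : psi φ y a b c d =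
    1 / 6 * ∑ σ : Equiv.Perm (Fin 7), (((Equiv.Perm.sign σ : ℤ) : ℝ) * phiZ (σ 0) (σ 1) (σ 2)) *
      (L (σ 3) a * L (σ 4) b * L (σ 5) c * L (σ 6) d) := by
  simp only [psi, sum_gInv_phi h, vol_mul_eps h, Fin.prod_univ_seven, Matrix.cons_val]
  congr 1
  have e : ∀ m n p, triple (L⁻¹ m) (L⁻¹ n) (L⁻¹ p) *
      ∑ σ : Equiv.Perm (Fin 7), ((Equiv.Perm.sign σ : ℤ) : ℝ) * (L (σ 0) m * L (σ 1) n *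
        L (σ 2) p * L (σ 3) a * L (σ 4) b * L (σ 5) c * L (σ 6) d) =
      ∑ x : Fin 7 × Fin 7 × Fin 7, (phiZ x.1 x.2.1 x.2.2 : ℝ) *
        (L⁻¹ m x.1 * L⁻¹ n x.2.1 * L⁻¹ p x.2.2 * ∑ σ : Equiv.Perm (Fin 7),
          (((Equiv.Perm.sign σ : ℤ) : ℝ) * (L (σ 3) a * L (σ 4) b * L (σ 5) c * L (σ 6) d)) *
            (L (σ 0) m * L (σ 1) n * L (σ 2) p)) := by
    intro m n p
    rw [triple_eq_sum_prod, Finset.sum_mul]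
    refine Finset.sum_congr rfl fun x _ => ?_
    rw [mul_assoc]
    congr 2
    exact Finset.sum_congr rfl fun σ _ => by ring
  simp only [e]
  trans ∑ x : Fin 7 × Fin 7 × Fin 7, (phiZ x.1 x.2.1 x.2.2 : ℝ) * ∑ m, ∑ n, ∑ p,
        (L⁻¹ m x.1 * L⁻¹ n x.2.1 * L⁻¹ p x.2.2 * ∑ σ : Equiv.Perm (Fin 7),
          (((Equiv.Perm.sign σ : ℤ) : ℝ) * (L (σ 3) a * L (σ 4) b * L (σ 5) c * L (σ 6) d)) *
            (L (σ 0) m * L (σ 1) n * L (σ 2) p))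
  · symm
    simp only [Finset.mul_sum (s := (Finset.univ : Finset (Fin 7)))]
    rw [Finset.sum_comm]
    refine Finset.sum_congr rfl fun m _ => ?_
    rw [Finset.sum_comm]
    refine Finset.sum_congr rfl fun n _ => ?_
    rw [Finset.sum_comm]
  · have e' : ∀ x : Fin 7 × Fin 7 × Fin 7, ∑ m, ∑ n, ∑ p,
        (L⁻¹ m x.1 * L⁻¹ n x.2.1 * L⁻¹ p x.2.2 * ∑ σ : Equiv.Perm (Fin 7),
          (((Equiv.Perm.sign σ : ℤ) : ℝ) * (L (σ 3) a * L (σ 4) b * L (σ 5) c * L (σ 6) d)) *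
            (L (σ 0) m * L (σ 1) n * L (σ 2) p)) = ∑ σ : Equiv.Perm (Fin 7),
          (((Equiv.Perm.sign σ : ℤ) : ℝ) * (L (σ 3) a * L (σ 4) b * L (σ 5) c * L (σ 6) d)) *
            ((if σ 0 = x.1 then 1 else 0) * (if σ 1 = x.2.1 then 1 else 0) *
              (if σ 2 = x.2.2 then 1 else 0)) := by
      intro x
      refine (sum_contract₃ (fun m => L⁻¹ m x.1) (fun n => L⁻¹ n x.2.1) (fun p => L⁻¹ p x.2.2)
        (fun σ : Equiv.Perm (Fin 7) => ((Equiv.Perm.sign σ : ℤ) : ℝ) *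
          (L (σ 3) a * L (σ 4) b * L (σ 5) c * L (σ 6) d))
        (fun σ => L (σ 0)) (fun σ => L (σ 1)) (fun σ => L (σ 2))).trans ?_
      simp only [sum_inv_mul h]
    simp only [e']
    simp only [Finset.mul_sum]
    rw [Finset.sum_comm]
    refine Finset.sum_congr rfl fun σ _ => ?_
    simp only [Fintype.sum_prod_type]
    simp
    ring

theorem sum_gInv_psi (h : IsFrame φ y L) (m b c d : Fin 7) :
    ∑ m', ∑ b', ∑ c', ∑ d', gInv φ y m m' * gInv φ y b b' * gInv φ y c c' * gInv φ y d d' *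
      psi φ y m' b' c' d' = 1 / 6 * ∑ σ : Equiv.Perm (Fin 7),
        (((Equiv.Perm.sign σ : ℤ) : ℝ) * phiZ (σ 0) (σ 1) (σ 2)) *
          (L⁻¹ m (σ 3) * L⁻¹ b (σ 4) * L⁻¹ c (σ 5) * L⁻¹ d (σ 6)) := by
  simp only [psi_eq h, mul_left_comm _ (1 / 6 : ℝ), ← Finset.mul_sum]
  congr 1
  refine (sum_contract₄ (gInv φ y m) (gInv φ y b) (gInv φ y c) (gInv φ y d)
    (fun σ : Equiv.Perm (Fin 7) => ((Equiv.Perm.sign σ : ℤ) : ℝ) * phiZ (σ 0) (σ 1) (σ 2))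
    (fun σ => L (σ 3)) (fun σ => L (σ 4)) (fun σ => L (σ 5)) (fun σ => L (σ 6))).trans ?_
  simp only [sum_gInv_mul h]

/-- The components of a 3-tensor in the frame given by `L`. -/
def toFrame (L : Matrix (Fin 7) (Fin 7) ℝ) (N : Fin 7 → Fin 7 → Fin 7 → ℝ) (a b c : Fin 7) : ℝ :=
  ∑ p, ∑ q, ∑ r, L⁻¹ p a * L⁻¹ q b * L⁻¹ r c * N p q r

/-- This puts the definition of `tors` in the form of hypothesis `ht` of `torsion_of_antisymm`. The
`1/6` in `psi` cancels the `6` of `sum_perm_phiZ`. -/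
theorem mulVec_tors (h : IsFrame φ y L) (i x : Fin 7) :
    48 * (L *ᵥ fun m => tors φ i m y) x = ∑ b, ∑ c, ∑ d,
      (psiZ x b c d : ℝ) * toFrame L (fun b c d => nablaPhi φ i b c d y) b c d := by
  have e : ∀ m, 48 * tors φ i m y = ∑ b, ∑ c, ∑ d, nablaPhi φ i b c d y *
      (1 / 6 * ∑ σ : Equiv.Perm (Fin 7),
        (((Equiv.Perm.sign σ : ℤ) : ℝ) * phiZ (σ 0) (σ 1) (σ 2)) *
          (L⁻¹ m (σ 3) * L⁻¹ b (σ 4) * L⁻¹ c (σ 5) * L⁻¹ d (σ 6))) := by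
    intro m
    simp only [tors, sum_gInv_psi h]
    ring
  have e₁ : ∀ m, 48 * tors φ i m y = 1 / 6 * ∑ σ : Equiv.Perm (Fin 7),
        ((Equiv.Perm.sign σ : ℤ) : ℝ) * (phiZ (σ 0) (σ 1) (σ 2) * (L⁻¹ m (σ 3) *
          toFrame L (fun b c d => nablaPhi φ i b c d y) (σ 4) (σ 5) (σ 6))) := by
    intro m
    rw [e]
    simp only [mul_left_comm _ (1 / 6 : ℝ), ← Finset.mul_sum, toFrame]
    congr 1
    simp only [Finset.mul_sum]
    symm
    rw [Finset.sum_comm]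
    refine Finset.sum_congr rfl fun b _ => ?_
    rw [Finset.sum_comm]
    refine Finset.sum_congr rfl fun c _ => ?_
    rw [Finset.sum_comm]
    exact Finset.sum_congr rfl fun d _ => Finset.sum_congr rfl fun σ _ => by ring
  have e₂ : ∀ m, 48 * tors φ i m y = ∑ a, ∑ b, ∑ c, ∑ d, (psiZ a b c d : ℝ) * (L⁻¹ m a *
          toFrame L (fun b c d => nablaPhi φ i b c d y) b c d) := by
    intro m
    rw [e₁, sum_perm_phiZ fun a b c d => L⁻¹ m a *
          toFrame L (fun b c d => nablaPhi φ i b c d y) b c d]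
    ring
  have e₃ : (fun m => 48 * tors φ i m y) = L⁻¹ *ᵥ fun a => ∑ b, ∑ c, ∑ d, (psiZ a b c d : ℝ) *
      toFrame L (fun b c d => nablaPhi φ i b c d y) b c d := by
    ext m
    simp only [e₂, Matrix.mulVec, dotProduct, Finset.mul_sum, mul_left_comm]
  have e₄ : (48 : ℝ) • (L *ᵥ fun m => tors φ i m y) = L *ᵥ fun m => 48 * tors φ i m y := by
    rw [← Matrix.mulVec_smul]
    rfl
  rw [e₃, Matrix.mulVec_mulVec, Matrix.mul_nonsing_inv _ h.1, Matrix.one_mulVec] at e₄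
  exact congrFun e₄ x

/-- The frame as an isomorphism from the octonions at `y` to the standard octonions. -/
def octFrame (L : Matrix (Fin 7) (Fin 7) ℝ) (A : Oct) : Oct := (A.1, L *ᵥ A.2)

theorem triple_mulVec (L : Matrix (Fin 7) (Fin 7) ℝ) (α β w : Fin 7 → ℝ) :
    ∑ i, ∑ j, triple (L.col i) (L.col j) w * (α i * β j) = triple (L *ᵥ α) (L *ᵥ β) w := by
  simp only [triple_eq_sum_prod, Finset.sum_mul, Matrix.col_apply, Matrix.mulVec, dotProduct]
  simp only [Finset.mul_sum, Finset.sum_mul]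
  symm
  rw [Finset.sum_comm]
  refine Finset.sum_congr rfl fun i _ => ?_
  rw [Finset.sum_comm]
  exact Finset.sum_congr rfl fun j _ => Finset.sum_congr rfl fun x _ => by ring

theorem mulVec_cross (h : IsFrame φ y L) (α β : Fin 7 → ℝ) :
    L *ᵥ cross φ y α β = cross0 (L *ᵥ α) (L *ᵥ β) := by
  have e : ∀ l, ∑ i, ∑ j, φ y i j l * α i * β j =
      ∑ c, L c l * cross0 (L *ᵥ α) (L *ᵥ β) c := by
    intro l
    have := triple_mulVec L α β (L.col l)
    simp only [h.2, mul_assoc]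
    rw [this]
    simp only [triple, cross0, Finset.mul_sum, Matrix.col_apply]
    rw [sum_rotate₃]
    exact Finset.sum_congr rfl fun a _ => Finset.sum_congr rfl fun b _ =>
      Finset.sum_congr rfl fun c _ => by ring
  have : cross φ y α β = L⁻¹ *ᵥ cross0 (L *ᵥ α) (L *ᵥ β) := by
    ext k
    simp only [cross, e]
    generalize cross0 (L *ᵥ α) (L *ᵥ β) = x
    simp only [Matrix.mulVec, dotProduct, Finset.mul_sum, ← sum_gInv_mul h,
      Finset.sum_mul, mul_assoc]
    rw [Finset.sum_comm]
  rw [this, Matrix.mulVec_mulVec, Matrix.mul_nonsing_inv _ h.1, Matrix.one_mulVec]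

/-- The fibre at `y` is isomorphic to the standard octonions, so algebraic identities may be checked
there. -/
theorem octFrame_mul (h : IsFrame φ y L) (A C : Oct) :
    octFrame L (mul φ y A C) = mul0 (octFrame L A) (octFrame L C) := by
  ext l
  · simp only [octFrame, mul, mul0, h.g_eq]
    congr 1
    rw [Matrix.dotProduct_mulVec, Matrix.vecMul_mulVec, ← Matrix.dotProduct_mulVec]
    simp only [dotProduct, Matrix.mulVec, Finset.mul_sum]
    exact Finset.sum_congr rfl fun i _ => Finset.sum_congr rfl fun j _ => by ring
  · simp [octFrame, mul, mul0, Matrix.mulVec_add, Matrix.mulVec_smul, mulVec_cross h]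

theorem octFrame_injective (h : IsFrame φ y L) : Function.Injective (octFrame L) := by
  intro A C hAC
  have h₁ := congrArg Prod.fst hAC
  have h₂ := congrArg (fun x : Oct => L⁻¹ *ᵥ x.2) hAC
  simp only [octFrame, Matrix.mulVec_mulVec, Matrix.nonsing_inv_mul _ h.1,
    Matrix.one_mulVec] at h₁ h₂
  exact Prod.ext h₁ h₂

end

/-! ### Connections on a trivial bundle with a bilinear product -/

section

section Connection

variable {E : Type*} [NormedAddCommGroup E] [NormedSpace ℝ E]

/-- The partial derivative `∂ᵢ f` of a vector-valued function. -/
def pdv (i : Fin 7) (f : R7 → E) (y : R7) : E := fderiv ℝ f y (EuclideanSpace.single i 1)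

theorem pdv_congr {f f' : R7 → E} {U : Set R7} (hU : IsOpen U) {y : R7} (hy : y ∈ U)
    (h : ∀ z ∈ U, f z = f' z) (i : Fin 7) : pdv i f y = pdv i f' y := by
  rw [pdv, pdv, Filter.EventuallyEq.fderiv_eq (Filter.eventuallyEq_of_mem (hU.mem_nhds hy) h)]

theorem pdv_add {f f' : R7 → E} {y : R7} (hf : DifferentiableAt ℝ f y)
    (hf' : DifferentiableAt ℝ f' y) (i : Fin 7) :
    pdv i (fun z => f z + f' z) y = pdv i f y + pdv i f' y := by
  simp only [pdv, fderiv_fun_add hf hf', _root_.add_apply]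

theorem pdv_sub {f f' : R7 → E} {y : R7} (hf : DifferentiableAt ℝ f y)
    (hf' : DifferentiableAt ℝ f' y) (i : Fin 7) :
    pdv i (fun z => f z - f' z) y = pdv i f y - pdv i f' y := by
  simp only [pdv, fderiv_fun_sub hf hf', _root_.sub_apply]

theorem pdv_clm_apply {F : Type*} [NormedAddCommGroup F] [NormedSpace ℝ F] {c : R7 → E →L[ℝ] F}
    {f : R7 → E} {y : R7} (hc : DifferentiableAt ℝ c y) (hf : DifferentiableAt ℝ f y) (i : Fin 7) :
    pdv i (fun z => c z (f z)) y = pdv i c y (f y) + c y (pdv i f y) := by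
  simp only [pdv, fderiv_clm_apply hc hf]
  simp [add_comm]

theorem pdv_clm_apply_const {F : Type*} [NormedAddCommGroup F] [NormedSpace ℝ F]
    {c : R7 → E →L[ℝ] F} {y : R7} (hc : DifferentiableAt ℝ c y) (a : E) (i : Fin 7) :
    pdv i (fun z => c z a) y = pdv i c y a := by
  rw [pdv_clm_apply hc (differentiableAt_const a)]
  simp [pdv]

theorem contDiffOn_pdv {f : R7 → E} {U : Set R7} (hU : IsOpen U) (hf : ContDiffOn ℝ ∞ f U)
    (i : Fin 7) : ContDiffOn ℝ ∞ (pdv i f) U :=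
  (hf.fderiv_of_isOpen hU (by simp)).clm_apply contDiffOn_const

theorem pdv_comm {f : R7 → E} {U : Set R7} (hU : IsOpen U) (hf : ContDiffOn ℝ ∞ f U) {y : R7}
    (hy : y ∈ U) (i j : Fin 7) : pdv i (pdv j f) y = pdv j (pdv i f) y := by
  have hfy : ContDiffAt ℝ ∞ f y := hf.contDiffAt (hU.mem_nhds hy)
  have hd : DifferentiableAt ℝ (fderiv ℝ f) y :=
    ((hf.fderiv_of_isOpen hU (m := ∞) (by simp)).contDiffAt (hU.mem_nhds hy)).differentiableAt
      (by simp)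
  have h : IsSymmSndFDerivAt ℝ f y := hfy.isSymmSndFDerivAt (by
    rw [minSmoothness_of_isRCLikeNormedField]; exact WithTop.coe_le_coe.2 (le_top : (2 : ℕ∞) ≤ ⊤))
  have e : ∀ i j : Fin 7, pdv i (pdv j f) y =
      fderiv ℝ (fderiv ℝ f) y (EuclideanSpace.single i 1) (EuclideanSpace.single j 1) :=
    fun i j => pdv_clm_apply_const hd _ i
  rw [e, e, h]

variable (μ : R7 → E →L[ℝ] E →L[ℝ] E) (Γ : Fin 7 → R7 → E →L[ℝ] E) (t : Fin 7 → R7 → E)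

/-- The covariant derivative with connection coefficients `Γ`. -/
def cov (i : Fin 7) (A : R7 → E) (y : R7) : E := pdv i A y + Γ i y (A y)

/-- The covariant derivative `∇ᵢ A - A tᵢ` for the product `μ`. -/
def covD (i : Fin 7) (A : R7 → E) (y : R7) : E := cov Γ i A y - μ y (A y) (t i y)

/-- The covariant derivative of the product `μ`. -/
def covMul (i : Fin 7) (y : R7) (a b : E) : E :=
  pdv i μ y a b + Γ i y (μ y a b) - μ y (Γ i y a) b - μ y a (Γ i y b)

/-- The curvature of the connection with coefficients `Γ`. -/
def curvOp (i j : Fin 7) (y : R7) (a : E) : E :=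
  pdv i (Γ j) y a - pdv j (Γ i) y a + (Γ i y (Γ j y a) - Γ j y (Γ i y a))

variable {μ Γ t} {U : Set R7} {y : R7}

theorem cov_mul {A B : R7 → E} (hμ : DifferentiableAt ℝ μ y) (hA : DifferentiableAt ℝ A y)
    (hB : DifferentiableAt ℝ B y) (i : Fin 7) : cov Γ i (fun z => μ z (A z) (B z)) y =
      μ y (cov Γ i A y) (B y) + μ y (A y) (cov Γ i B y) + covMul μ Γ i y (A y) (B y) := by
  have h : pdv i (fun z => μ z (A z) (B z)) y = _ :=
    pdv_clm_apply (c := fun z => μ z (A z)) (hμ.clm_apply hA) hB i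
  simp only [cov, h, pdv_clm_apply hμ hA, covMul, _root_.add_apply, map_add]
  abel

theorem contDiffOn_cov (hU : IsOpen U) (hΓ : ∀ i, ContDiffOn ℝ ∞ (Γ i) U) {A : R7 → E}
    (hA : ContDiffOn ℝ ∞ A U) (i : Fin 7) : ContDiffOn ℝ ∞ (cov Γ i A) U :=
  (contDiffOn_pdv hU hA i).add ((hΓ i).clm_apply hA)

theorem contDiffOn_covD (hU : IsOpen U) (hμ : ContDiffOn ℝ ∞ μ U)
    (hΓ : ∀ i, ContDiffOn ℝ ∞ (Γ i) U) (ht : ∀ i, ContDiffOn ℝ ∞ (t i) U) {A : R7 → E}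
    (hA : ContDiffOn ℝ ∞ A U) (i : Fin 7) : ContDiffOn ℝ ∞ (covD μ Γ t i A) U :=
  (contDiffOn_cov hU hΓ hA i).sub ((hμ.clm_apply hA).clm_apply (ht i))

theorem differentiableAt_of_contDiffOn {F : Type*} [NormedAddCommGroup F] [NormedSpace ℝ F]
    {f : R7 → F} (hf : ContDiffOn ℝ ∞ f U) (hU : IsOpen U) (hy : y ∈ U) :
    DifferentiableAt ℝ f y :=
  (hf.contDiffAt (hU.mem_nhds hy)).differentiableAt (by simp)

theorem cov_sub {A B : R7 → E} (hA : DifferentiableAt ℝ A y) (hB : DifferentiableAt ℝ B y)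
    (i : Fin 7) : cov Γ i (fun z => A z - B z) y = cov Γ i A y - cov Γ i B y := by
  simp only [cov, pdv_sub hA hB, map_sub]
  abel

theorem cov_add {A B : R7 → E} (hA : DifferentiableAt ℝ A y) (hB : DifferentiableAt ℝ B y)
    (i : Fin 7) : cov Γ i (fun z => A z + B z) y = cov Γ i A y + cov Γ i B y := by
  simp only [cov, pdv_add hA hB, map_add]
  abel

theorem covD_add {A B : R7 → E} (hA : DifferentiableAt ℝ A y) (hB : DifferentiableAt ℝ B y)
    (i : Fin 7) :
    covD μ Γ t i (fun z => A z + B z) y = covD μ Γ t i A y + covD μ Γ t i B y := by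
  simp only [covD, cov_add hA hB, map_add, _root_.add_apply]
  abel

theorem covD_sub {A B : R7 → E} (hA : DifferentiableAt ℝ A y) (hB : DifferentiableAt ℝ B y)
    (i : Fin 7) :
    covD μ Γ t i (fun z => A z - B z) y = covD μ Γ t i A y - covD μ Γ t i B y := by
  simp only [covD, cov_sub hA hB, map_sub, _root_.sub_apply]
  abel

theorem cov_congr {f f' : R7 → E} (hU : IsOpen U) (hy : y ∈ U)
    (h : ∀ z ∈ U, f z = f' z) (i : Fin 7) : cov Γ i f y = cov Γ i f' y := by
  rw [cov, cov, pdv_congr hU hy h, h y hy]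

theorem covD_congr {f f' : R7 → E} (hU : IsOpen U) (hy : y ∈ U)
    (h : ∀ z ∈ U, f z = f' z) (i : Fin 7) : covD μ Γ t i f y = covD μ Γ t i f' y := by
  rw [covD, covD, cov_congr hU hy h, h y hy]

theorem cov_comm (hU : IsOpen U) (hy : y ∈ U) (hΓ : ∀ i, ContDiffOn ℝ ∞ (Γ i) U) {A : R7 → E}
    (hA : ContDiffOn ℝ ∞ A U) (i j : Fin 7) :
    cov Γ i (cov Γ j A) y - cov Γ j (cov Γ i A) y = curvOp Γ i j y (A y) := by
  have dA := differentiableAt_of_contDiffOn hA hU hy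
  have dΓ := fun i => (differentiableAt_of_contDiffOn (hΓ i) hU hy)
  have e : ∀ i j, cov Γ i (cov Γ j A) y = pdv i (pdv j A) y + (pdv i (Γ j) y (A y) +
      Γ j y (pdv i A y)) + Γ i y (pdv j A y + Γ j y (A y)) := by
    intro i j
    have := pdv_add ((differentiableAt_of_contDiffOn (contDiffOn_pdv hU hA j) hU hy))
      ((dΓ j).clm_apply dA) i
    rw [pdv_clm_apply (dΓ j) dA] at this
    rw [cov]
    simp only [← this]
    rfl
  rw [e, e, pdv_comm hU hA hy i j, curvOp]
  simp only [map_add]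
  abel

/-- By `hμt` the derivative of the product is an associator with `t`. It turns `(AB)t` into `A(Bt)`,
so the torsion term acts on the second factor alone. -/
theorem covD_mul (hμ : DifferentiableAt ℝ μ y) {i : Fin 7}
    (hμt : ∀ a b, covMul μ Γ i y a b = μ y (μ y a b) (t i y) - μ y a (μ y b (t i y)))
    {A B : R7 → E} (hA : DifferentiableAt ℝ A y) (hB : DifferentiableAt ℝ B y) :
    covD μ Γ t i (fun z => μ z (A z) (B z)) y =
      μ y (cov Γ i A y) (B y) + μ y (A y) (covD μ Γ t i B y) := by
  simp only [covD, cov_mul hμ hA hB, hμt, map_sub]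
  abel

theorem covD_comm (hU : IsOpen U) (hy : y ∈ U) (hμ : ContDiffOn ℝ ∞ μ U)
    (hΓ : ∀ i, ContDiffOn ℝ ∞ (Γ i) U) (ht : ∀ i, ContDiffOn ℝ ∞ (t i) U)
    (hμt : ∀ i a b, covMul μ Γ i y a b = μ y (μ y a b) (t i y) - μ y a (μ y b (t i y)))
    {A : R7 → E} (hA : ContDiffOn ℝ ∞ A U) (i j : Fin 7) :
    covD μ Γ t i (covD μ Γ t j A) y - covD μ Γ t j (covD μ Γ t i A) y = curvOp Γ i j y (A y) -
      μ y (A y) (covD μ Γ t i (t j) y - covD μ Γ t j (t i) y) := by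
  have dA := differentiableAt_of_contDiffOn hA hU hy
  have dμ := differentiableAt_of_contDiffOn hμ hU hy
  have dt := fun i => (differentiableAt_of_contDiffOn (ht i) hU hy)
  have e : ∀ i j, covD μ Γ t i (covD μ Γ t j A) y = cov Γ i (cov Γ j A) y -
      μ y (cov Γ j A y) (t i y) - (μ y (cov Γ i A y) (t j y) +
        μ y (A y) (covD μ Γ t i (t j) y)) := by
    intro i j
    have dc := (differentiableAt_of_contDiffOn (contDiffOn_cov hU hΓ hA j) hU hy)
    have := covD_sub (μ := μ) (Γ := Γ) (t := t) dc ((dμ.clm_apply dA).clm_apply (dt j)) i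
    rw [covD_mul dμ (hμt i) dA (dt j)] at this
    exact this
  rw [e, e, ← cov_comm hU hy hΓ hA, map_sub]
  abel

/-- The commutator of `D` on `ab` is computed directly by `covD_comm`, and also by two applications
of the product rule. In the latter the mixed terms are symmetric in `i` and `j` and cancel. -/
theorem curvOp_mul (hU : IsOpen U) (hy : y ∈ U) (hμ : ContDiffOn ℝ ∞ μ U)
    (hΓ : ∀ i, ContDiffOn ℝ ∞ (Γ i) U) (ht : ∀ i, ContDiffOn ℝ ∞ (t i) U)
    (hμt : ∀ z ∈ U, ∀ i a b, covMul μ Γ i z a b =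
      μ z (μ z a b) (t i z) - μ z a (μ z b (t i z))) (i j : Fin 7) (a b : E) :
    curvOp Γ i j y (μ y a b) - μ y (curvOp Γ i j y a) b - μ y a (curvOp Γ i j y b) =
      μ y (μ y a b) (covD μ Γ t i (t j) y - covD μ Γ t j (t i) y) -
        μ y a (μ y b (covD μ Γ t i (t j) y - covD μ Γ t j (t i) y)) := by
  have dμ := differentiableAt_of_contDiffOn hμ hU hy
  have ca : ContDiffOn ℝ ∞ (fun _ : R7 => a) U := contDiffOn_const
  have cb : ContDiffOn ℝ ∞ (fun _ : R7 => b) U := contDiffOn_const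
  have e : ∀ i j, covD μ Γ t i (covD μ Γ t j (fun z => μ z a b)) y =
      (μ y (cov Γ i (cov Γ j fun _ => a) y) b + μ y (cov Γ j (fun _ => a) y)
        (covD μ Γ t i (fun _ => b) y)) + (μ y (cov Γ i (fun _ => a) y)
          (covD μ Γ t j (fun _ => b) y) + μ y a (covD μ Γ t i (covD μ Γ t j fun _ => b) y)) := by
    intro i j
    -- This product rule is about to be differentiated, which is why `hμt` is needed on all of `U`
    -- and not only at `y`.
    have h₁ : ∀ z ∈ U, covD μ Γ t j (fun z => μ z a b) z = μ z (cov Γ j (fun _ => a) z) b +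
        μ z a (covD μ Γ t j (fun _ => b) z) := fun z hz =>
      covD_mul (differentiableAt_of_contDiffOn hμ hU hz) (hμt z hz j)
        (differentiableAt_const a) (differentiableAt_const b)
    have c₁ := contDiffOn_cov hU hΓ ca j
    have c₂ := contDiffOn_covD hU hμ hΓ ht cb j
    rw [covD_congr hU hy h₁, covD_add
      ((differentiableAt_of_contDiffOn ((hμ.clm_apply c₁).clm_apply cb) hU hy))
      ((differentiableAt_of_contDiffOn ((hμ.clm_apply ca).clm_apply c₂) hU hy)),
      covD_mul dμ (hμt y hy i) (differentiableAt_of_contDiffOn c₁ hU hy) (differentiableAt_const b),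
      covD_mul dμ (hμt y hy i) (differentiableAt_const a) (differentiableAt_of_contDiffOn c₂ hU hy)]
  have h := covD_comm hU hy hμ hΓ ht (hμt y hy) ((hμ.clm_apply ca).clm_apply cb) i j
  have hb := covD_comm hU hy hμ hΓ ht (hμt y hy) cb i j
  have ha := cov_comm hU hy hΓ ca i j
  rw [e, e] at h
  rw [eq_sub_iff_add_eq] at h hb
  rw [← h, ← hb, ← ha]
  simp only [map_sub, map_add, _root_.sub_apply]
  abel

end Connection

end

/-! ### Smoothness of the geometric objects, and their coordinate-free form -/

section

theorem contDiffOn_det {n : ℕ} {M : R7 → Matrix (Fin n) (Fin n) ℝ} {U : Set R7}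
    (hM : ∀ i j, ContDiffOn ℝ ∞ (fun z => M z i j) U) : ContDiffOn ℝ ∞ (fun z => (M z).det) U := by
  simp only [Matrix.det_apply']
  exact ContDiffOn.sum fun σ _ => contDiffOn_const.mul (contDiffOn_prod fun i _ => hM _ _)

theorem contDiffOn_inv {n : ℕ} {M : R7 → Matrix (Fin n) (Fin n) ℝ} {U : Set R7}
    (hM : ∀ i j, ContDiffOn ℝ ∞ (fun z => M z i j) U) (hU : ∀ z ∈ U, (M z).det ≠ 0)
    (i j : Fin n) : ContDiffOn ℝ ∞ (fun z => (M z)⁻¹ i j) U := by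
  simp only [Matrix.inv_def, Matrix.smul_apply, smul_eq_mul, Ring.inverse_eq_inv',
    Matrix.adjugate_apply]
  refine ((contDiffOn_det hM).inv hU).mul (contDiffOn_det fun a b => ?_)
  simp only [Matrix.updateRow_apply]
  split_ifs
  · exact contDiffOn_const
  · exact hM a b

theorem contDiffAt_sign_mul_rpow {x : ℝ} (hx : x ≠ 0) (p : ℝ) :
    ContDiffAt ℝ ∞ (fun x : ℝ => SignType.sign x * |x| ^ p) x := by
  rcases lt_or_gt_of_ne hx with h | h
  · have : ContDiffAt ℝ ∞ (fun x : ℝ => -((-x) ^ p)) x :=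
      (ContDiffAt.rpow_const_of_ne contDiffAt_id.neg (by simpa using hx)).neg
    refine this.congr_of_eventuallyEq ?_
    filter_upwards [Iio_mem_nhds h] with z hz
    have hz' : z < 0 := hz
    simp [sign_neg hz', abs_of_neg hz']
  · have : ContDiffAt ℝ ∞ (fun x : ℝ => x ^ p) x := Real.contDiffAt_rpow_const_of_ne hx
    refine this.congr_of_eventuallyEq ?_
    filter_upwards [Ioi_mem_nhds h] with z hz
    have hz' : 0 < z := hz
    simp [sign_pos hz', abs_of_pos hz']

/-- `φ` gives on the open set `U` the components of a smooth positive 3-form. -/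
structure IsG2On (φ : Form3) (U : Set R7) : Prop where
  isOpen : IsOpen U
  smooth : ∀ i j k, ContDiffOn ℝ ∞ (fun y => φ y i j k) U
  frame : ∀ y ∈ U, ∃ L, IsFrame φ y L

variable {φ : Form3} {U : Set R7}

theorem pd_eq_pdv (i : Fin 7) (f : R7 → ℝ) : pd i f = pdv i f := rfl

theorem IsG2On.contDiffOn_B (h : IsG2On φ U) (i j : Fin 7) :
    ContDiffOn ℝ ∞ (fun z => B φ z i j) U := by
  simp only [B, Matrix.of_apply]
  refine contDiffOn_const.mul (contDiffOn_const.mul (ContDiffOn.sum fun σ _ =>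
    contDiffOn_const.mul ?_))
  exact ((h.smooth _ _ _).mul (h.smooth _ _ _)).mul (h.smooth _ _ _)

theorem IsFrame.det_B_ne_zero {y : R7} {L : Matrix (Fin 7) (Fin 7) ℝ} (h : IsFrame φ y L) :
    (B φ y).det ≠ 0 := by
  have := h.1.ne_zero
  rw [h.B_eq, Matrix.det_smul, Matrix.det_mul, Matrix.det_transpose]
  positivity

theorem IsFrame.det_g_ne_zero {y : R7} {L : Matrix (Fin 7) (Fin 7) ℝ} (h : IsFrame φ y L) :
    (g φ y).det ≠ 0 := by
  have := h.1.ne_zero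
  rw [h.g_eq, Matrix.det_mul, Matrix.det_transpose]
  positivity

theorem IsG2On.contDiffOn_vol (h : IsG2On φ U) : ContDiffOn ℝ ∞ (vol φ) U := by
  intro y hy
  obtain ⟨L, hL⟩ := h.frame y hy
  exact (contDiffAt_sign_mul_rpow hL.det_B_ne_zero _).comp_contDiffWithinAt y
    (contDiffOn_det h.contDiffOn_B y hy)

theorem IsG2On.contDiffOn_g (h : IsG2On φ U) (i j : Fin 7) :
    ContDiffOn ℝ ∞ (fun z => g φ z i j) U := by
  simp only [g, Matrix.of_apply]
  refine (h.contDiffOn_B i j).div h.contDiffOn_vol fun y hy => ?_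
  obtain ⟨L, hL⟩ := h.frame y hy
  rw [hL.vol_eq]
  exact hL.1.ne_zero

theorem IsG2On.contDiffOn_gInv (h : IsG2On φ U) (i j : Fin 7) :
    ContDiffOn ℝ ∞ (fun z => gInv φ z i j) U := by
  refine contDiffOn_inv h.contDiffOn_g (fun y hy => ?_) i j
  obtain ⟨L, hL⟩ := h.frame y hy
  exact hL.det_g_ne_zero

theorem IsG2On.contDiffOn_Gam (h : IsG2On φ U) (k i j : Fin 7) :
    ContDiffOn ℝ ∞ (Gam φ k i j) U := by
  have hd : ∀ i k l, ContDiffOn ℝ ∞ (pd i fun z => g φ z k l) U := fun i k l =>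
    contDiffOn_pdv h.isOpen (h.contDiffOn_g k l) i
  refine contDiffOn_const.mul (ContDiffOn.sum fun l _ => (h.contDiffOn_gInv k l).mul ?_)
  exact ((hd _ _ _).add (hd _ _ _)).sub (hd _ _ _)

theorem IsG2On.contDiffOn_psi (h : IsG2On φ U) (a b c d : Fin 7) :
    ContDiffOn ℝ ∞ (fun z => psi φ z a b c d) U := by
  refine contDiffOn_const.mul (ContDiffOn.sum fun m _ => ContDiffOn.sum fun n _ =>
    ContDiffOn.sum fun p _ => ContDiffOn.mul (ContDiffOn.sum fun m' _ => ContDiffOn.sum fun n' _ =>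
      ContDiffOn.sum fun p' _ => ?_) (h.contDiffOn_vol.mul contDiffOn_const))
  exact (((h.contDiffOn_gInv _ _).mul (h.contDiffOn_gInv _ _)).mul (h.contDiffOn_gInv _ _)).mul
    (h.smooth _ _ _)

theorem IsG2On.contDiffOn_nablaPhi (h : IsG2On φ U) (a b c d : Fin 7) :
    ContDiffOn ℝ ∞ (nablaPhi φ a b c d) U := by
  refine (contDiffOn_pdv h.isOpen (h.smooth b c d) a).sub (ContDiffOn.sum fun q _ => ?_)
  exact (((h.contDiffOn_Gam _ _ _).mul (h.smooth _ _ _)).add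
    ((h.contDiffOn_Gam _ _ _).mul (h.smooth _ _ _))).add
      ((h.contDiffOn_Gam _ _ _).mul (h.smooth _ _ _))

theorem IsG2On.contDiffOn_tors (h : IsG2On φ U) (a m : Fin 7) :
    ContDiffOn ℝ ∞ (tors φ a m) U := by
  refine contDiffOn_const.mul (ContDiffOn.sum fun b _ => ContDiffOn.sum fun c _ =>
    ContDiffOn.sum fun d _ => (h.contDiffOn_nablaPhi a b c d).mul (ContDiffOn.sum fun m' _ =>
      ContDiffOn.sum fun b' _ => ContDiffOn.sum fun c' _ => ContDiffOn.sum fun d' _ => ?_))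
  exact ((((h.contDiffOn_gInv _ _).mul (h.contDiffOn_gInv _ _)).mul (h.contDiffOn_gInv _ _)).mul
    (h.contDiffOn_gInv _ _)).mul (h.contDiffOn_psi _ _ _ _)

theorem IsG2On.contDiffOn_T (h : IsG2On φ U) (a : Fin 7) : ContDiffOn ℝ ∞ (T φ a) U :=
  contDiffOn_const.prodMk (contDiffOn_pi.2 fun m => h.contDiffOn_tors a m)

theorem deltaUp_eq (i : Fin 7) (y : R7) : deltaUp φ i y = (0, fun k => gInv φ y i k) := by
  ext k
  · simp [deltaUp, Prod.fst_sum]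
  · simp [deltaUp, Prod.snd_sum, Pi.single_apply]

theorem IsG2On.contDiffOn_deltaUp (h : IsG2On φ U) (i : Fin 7) :
    ContDiffOn ℝ ∞ (deltaUp φ i) U := by
  refine (contDiffOn_const.prodMk (contDiffOn_pi.2 fun k => h.contDiffOn_gInv i k)).congr
    fun y _ => deltaUp_eq i y

theorem mul_add_left (y : R7) (A A' C : Oct) :
    mul φ y (A + A') C = mul φ y A C + mul φ y A' C := by
  ext k
  · simp [mul, mul_add, add_mul, Finset.sum_add_distrib]
    ring
  · simp [mul, cross, mul_add, add_mul, Finset.sum_add_distrib]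
    ring

theorem mul_smul_left (y : R7) (c : ℝ) (A C : Oct) : mul φ y (c • A) C = c • mul φ y A C := by
  ext k
  · simp [mul, Finset.mul_sum, mul_sub]
    ring_nf
  · simp [mul, cross, Finset.mul_sum]
    ring_nf

theorem mul_add_right (y : R7) (A C C' : Oct) :
    mul φ y A (C + C') = mul φ y A C + mul φ y A C' := by
  ext k
  · simp [mul, mul_add, Finset.sum_add_distrib]
    ring
  · simp [mul, cross, mul_add, add_mul, Finset.sum_add_distrib]
    ring

theorem mul_smul_right (y : R7) (c : ℝ) (A C : Oct) : mul φ y A (c • C) = c • mul φ y A C := by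
  ext k
  · simp [mul, Finset.mul_sum, mul_sub]
    ring_nf
  · simp [mul, cross, Finset.mul_sum]
    ring_nf

variable (φ) in
/-- The octonion product as a continuous bilinear map. -/
def mulL (y : R7) : Oct →L[ℝ] Oct →L[ℝ] Oct :=
  (LinearMap.mk₂ ℝ (mul φ y) (mul_add_left y) (mul_smul_left y) (mul_add_right y)
    (mul_smul_right y)).toContinuousBilinearMap

theorem mulL_apply (y : R7) (A C : Oct) : mulL φ y A C = mul φ y A C := rfl

variable (φ) in
/-- The connection coefficients of the octonion bundle as linear maps. -/
def GamL (i : Fin 7) (y : R7) : Oct →L[ℝ] Oct :=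
  LinearMap.toContinuousLinearMap
    { toFun := fun A => (0, fun k => ∑ j, Gam φ k i j y * A.2 j)
      map_add' := fun A C => by
        ext k <;> simp [mul_add, Finset.sum_add_distrib]
      map_smul' := fun c A => by
        ext k <;> simp [Finset.mul_sum, mul_left_comm] }

theorem GamL_apply (i : Fin 7) (y : R7) (A : Oct) :
    GamL φ i y A = (0, fun k => ∑ j, Gam φ k i j y * A.2 j) := rfl

theorem IsG2On.contDiffOn_cross (h : IsG2On φ U) (α β : Fin 7 → ℝ) (k : Fin 7) :
    ContDiffOn ℝ ∞ (fun y => cross φ y α β k) U := by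
  refine ContDiffOn.sum fun l _ => (h.contDiffOn_gInv k l).mul (ContDiffOn.sum fun i _ =>
    ContDiffOn.sum fun j _ => ?_)
  exact ((h.smooth _ _ _).mul contDiffOn_const).mul contDiffOn_const

theorem IsG2On.contDiffOn_mulL (h : IsG2On φ U) : ContDiffOn ℝ ∞ (mulL φ) U := by
  refine contDiffOn_clm_apply.2 fun A => contDiffOn_clm_apply.2 fun C => ?_
  refine ContDiffOn.prodMk ?_ (contDiffOn_pi.2 fun k => ?_)
  · refine contDiffOn_const.sub (ContDiffOn.sum fun i _ => ContDiffOn.sum fun j _ => ?_)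
    exact ((h.contDiffOn_g _ _).mul contDiffOn_const).mul contDiffOn_const
  · exact contDiffOn_const.add (h.contDiffOn_cross _ _ _)

theorem IsG2On.contDiffOn_GamL (h : IsG2On φ U) (i : Fin 7) : ContDiffOn ℝ ∞ (GamL φ i) U := by
  refine contDiffOn_clm_apply.2 fun A => contDiffOn_const.prodMk (contDiffOn_pi.2 fun k => ?_)
  exact ContDiffOn.sum fun j _ => (h.contDiffOn_Gam _ _ _).mul contDiffOn_const

theorem pdv_fst {A : R7 → Oct} {y : R7} (hA : DifferentiableAt ℝ A y) (i : Fin 7) :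
    (pdv i A y).1 = pd i (fun z => (A z).1) y := by
  rw [pdv, pd, fderiv.fst hA]
  rfl

theorem pdv_snd {A : R7 → Oct} {y : R7} (hA : DifferentiableAt ℝ A y) (i k : Fin 7) :
    (pdv i A y).2 k = pd i (fun z => (A z).2 k) y := by
  have h : HasFDerivAt (fun z => (A z).2 k)
      ((ContinuousLinearMap.proj k).comp ((ContinuousLinearMap.snd ℝ ℝ (Fin 7 → ℝ)).comp
        (fderiv ℝ A y))) y :=
    ((ContinuousLinearMap.proj (R := ℝ) (φ := fun _ : Fin 7 => ℝ) k).comp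
      (ContinuousLinearMap.snd ℝ ℝ (Fin 7 → ℝ))).hasFDerivAt.comp y hA.hasFDerivAt
  rw [pd, h.fderiv]
  rfl

/-- `nabla` differentiates each component separately. Differentiability of the pair is what
identifies this with the derivative of the vector-valued map. -/
theorem nabla_eq_cov {A : R7 → Oct} {y : R7} (hA : DifferentiableAt ℝ A y) (i : Fin 7) :
    nabla φ i A y = cov (GamL φ) i A y := by
  ext k
  · simp [nabla, cov, GamL_apply, pdv_fst hA]
  · simp [nabla, cov, GamL_apply, pdv_snd hA]

theorem D_eq_covD {A : R7 → Oct} {y : R7} (hA : DifferentiableAt ℝ A y) (i : Fin 7) :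
    D φ i A y = covD (mulL φ) (GamL φ) (T φ) i A y := by
  rw [D, covD, nabla_eq_cov hA, mulL_apply]

end

/-! ### The covariant derivative of the octonion product -/

section

theorem pd_sum {ι : Type*} [Fintype ι] {f : ι → R7 → ℝ} {y : R7}
    (hf : ∀ k, DifferentiableAt ℝ (f k) y) (i : Fin 7) :
    pd i (fun z => ∑ k, f k z) y = ∑ k, pd i (f k) y := by
  simp only [pd]
  rw [fderiv_fun_sum fun k _ => hf k]
  simp

theorem pd_mul {f f' : R7 → ℝ} {y : R7} (hf : DifferentiableAt ℝ f y)
    (hf' : DifferentiableAt ℝ f' y) (i : Fin 7) :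
    pd i (fun z => f z * f' z) y = pd i f y * f' y + f y * pd i f' y := by
  simp only [pd, fderiv_fun_mul hf hf', _root_.add_apply, _root_.smul_apply, smul_eq_mul]
  ring

theorem pd_mul_const {f : R7 → ℝ} {y : R7} (hf : DifferentiableAt ℝ f y) (c : ℝ) (i : Fin 7) :
    pd i (fun z => f z * c) y = pd i f y * c := by
  rw [pd_mul hf (differentiableAt_const c)]
  simp [pd]

variable {φ : Form3} {U : Set R7} {y : R7} {L : Matrix (Fin 7) (Fin 7) ℝ}

theorem IsFrame.g_comm (h : IsFrame φ y L) (i j : Fin 7) : g φ y i j = g φ y j i := by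
  rw [h.g_eq, ← Matrix.transpose_apply (Lᵀ * L) i j, Matrix.transpose_mul,
    Matrix.transpose_transpose]

theorem IsFrame.gInv_mul_g (h : IsFrame φ y L) : gInv φ y * g φ y = 1 :=
  Matrix.nonsing_inv_mul _ h.det_g_ne_zero.isUnit

theorem IsFrame.g_mul_gInv (h : IsFrame φ y L) : g φ y * gInv φ y = 1 :=
  Matrix.mul_nonsing_inv _ h.det_g_ne_zero.isUnit

theorem IsFrame.sum_g_mul_gInv (h : IsFrame φ y L) (m : Fin 7) (x : Fin 7 → ℝ) :
    ∑ k, g φ y m k * ∑ l, gInv φ y k l * x l = x m := by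
  have := congrFun (congrArg (fun M => M *ᵥ x) h.g_mul_gInv) m
  rw [← Matrix.mulVec_mulVec, Matrix.one_mulVec] at this
  exact this

theorem triple_swap₁₂ (u v w : Fin 7 → ℝ) : triple v u w = -triple u v w := by
  simp only [triple, ← Finset.sum_neg_distrib]
  rw [Finset.sum_comm]
  refine Finset.sum_congr rfl fun a _ => Finset.sum_congr rfl fun b _ =>
    Finset.sum_congr rfl fun c _ => ?_
  rw [phiZ_swap₁₂ a b c]
  push_cast
  ring

theorem triple_swap₂₃ (u v w : Fin 7 → ℝ) : triple u w v = -triple u v w := by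
  simp only [triple, ← Finset.sum_neg_distrib]
  refine Finset.sum_congr rfl fun a _ => ?_
  rw [Finset.sum_comm]
  refine Finset.sum_congr rfl fun b _ =>
    Finset.sum_congr rfl fun c _ => ?_
  rw [phiZ_swap₂₃ a b c]
  push_cast
  ring

theorem pd_congr_neg (hU : IsOpen U) (hy : y ∈ U) {f f' : R7 → ℝ} (h : ∀ z ∈ U, f z = -f' z)
    (i : Fin 7) : pd i f y = -pd i f' y := by
  rw [pd_eq_pdv, pdv_congr hU hy h]
  simp [pdv, pd]

theorem IsG2On.pd_g_comm (h : IsG2On φ U) (hy : y ∈ U) (i j k : Fin 7) :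
    pd i (fun z => g φ z j k) y = pd i (fun z => g φ z k j) y :=
  pdv_congr h.isOpen hy (fun z hz => by obtain ⟨L, hL⟩ := h.frame z hz; exact hL.g_comm j k) i

theorem IsG2On.Gam_comm (h : IsG2On φ U) (hy : y ∈ U) (k i j : Fin 7) :
    Gam φ k i j y = Gam φ k j i y := by
  simp only [Gam, h.pd_g_comm hy _ i j]
  congr 1
  exact Finset.sum_congr rfl fun l _ => by ring

theorem IsG2On.sum_g_mul_Gam (h : IsG2On φ U) (hy : y ∈ U) (m i j : Fin 7) :
    ∑ k, g φ y m k * Gam φ k i j y = 1 / 2 * (pd i (fun z => g φ z j m) y +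
      pd j (fun z => g φ z i m) y - pd m (fun z => g φ z i j) y) := by
  obtain ⟨L, hL⟩ := h.frame y hy
  simp only [Gam, mul_left_comm _ (1 / 2 : ℝ), ← Finset.mul_sum]
  rw [hL.sum_g_mul_gInv m]

theorem IsG2On.pd_g (h : IsG2On φ U) (hy : y ∈ U) (i k l : Fin 7) :
    pd i (fun z => g φ z k l) y =
      ∑ m, Gam φ m i k y * g φ y m l + ∑ m, Gam φ m i l y * g φ y k m := by
  obtain ⟨L, hL⟩ := h.frame y hy
  have h₁ := h.sum_g_mul_Gam hy l i k
  have h₂ := h.sum_g_mul_Gam hy k i l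
  simp only [mul_comm (Gam _ _ _ _ _), hL.g_comm _ l]
  rw [h₁, h₂, h.pd_g_comm hy i l k, h.pd_g_comm hy k i l, h.pd_g_comm hy l i k,
    h.pd_g_comm hy k l i]
  ring

theorem IsG2On.phi_swap (h : IsG2On φ U) (hy : y ∈ U) (b c d : Fin 7) :
    φ y c b d = -φ y b c d ∧ φ y b d c = -φ y b c d := by
  obtain ⟨L, hL⟩ := h.frame y hy
  simp only [hL.2]
  exact ⟨triple_swap₁₂ _ _ _, triple_swap₂₃ _ _ _⟩

theorem IsG2On.nablaPhi_swap₁₂ (h : IsG2On φ U) (hy : y ∈ U) (a b c d : Fin 7) :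
    nablaPhi φ a c b d y = -nablaPhi φ a b c d y := by
  have hp : pd a (fun z => φ z c b d) y = -pd a (fun z => φ z b c d) y :=
    pd_congr_neg h.isOpen hy (fun z hz => (h.phi_swap hz b c d).1) a
  simp only [nablaPhi, hp, neg_sub', ← Finset.sum_neg_distrib]
  congr 1
  refine Finset.sum_congr rfl fun q _ => ?_
  rw [(h.phi_swap hy b q d).1, (h.phi_swap hy q c d).1, (h.phi_swap hy b c q).1]
  ring

theorem IsG2On.nablaPhi_swap₂₃ (h : IsG2On φ U) (hy : y ∈ U) (a b c d : Fin 7) :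
    nablaPhi φ a b d c y = -nablaPhi φ a b c d y := by
  have hp : pd a (fun z => φ z b d c) y = -pd a (fun z => φ z b c d) y :=
    pd_congr_neg h.isOpen hy (fun z hz => (h.phi_swap hz b c d).2) a
  simp only [nablaPhi, hp, neg_sub', ← Finset.sum_neg_distrib]
  congr 1
  refine Finset.sum_congr rfl fun q _ => ?_
  rw [(h.phi_swap hy q c d).2, (h.phi_swap hy b c q).2, (h.phi_swap hy b q d).2]
  ring

theorem toFrame_swap₁₂ {N : Fin 7 → Fin 7 → Fin 7 → ℝ} (hN : ∀ a b c, N b a c = -N a b c)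
    (a b c : Fin 7) : toFrame L N b a c = -toFrame L N a b c := by
  simp only [toFrame, ← Finset.sum_neg_distrib]
  rw [Finset.sum_comm]
  refine Finset.sum_congr rfl fun p _ => Finset.sum_congr rfl fun q _ =>
    Finset.sum_congr rfl fun r _ => ?_
  rw [hN p q r]
  ring

theorem toFrame_swap₂₃ {N : Fin 7 → Fin 7 → Fin 7 → ℝ} (hN : ∀ a b c, N a c b = -N a b c)
    (a b c : Fin 7) : toFrame L N a c b = -toFrame L N a b c := by
  simp only [toFrame, ← Finset.sum_neg_distrib]
  refine Finset.sum_congr rfl fun p _ => ?_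
  rw [Finset.sum_comm]
  refine Finset.sum_congr rfl fun q _ =>
    Finset.sum_congr rfl fun r _ => ?_
  rw [hN p q r]
  ring

theorem IsG2On.pdv_mulL (h : IsG2On φ U) (hy : y ∈ U) (i : Fin 7) (a b : Oct) :
    pdv i (mulL φ) y a b = pdv i (fun z => mul φ z a b) y := by
  have hμ := differentiableAt_of_contDiffOn h.contDiffOn_mulL h.isOpen hy
  rw [← pdv_clm_apply_const hμ a, ← pdv_clm_apply_const (hμ.clm_apply (differentiableAt_const a)) b]
  rfl

theorem IsG2On.differentiableAt_mul (h : IsG2On φ U) (hy : y ∈ U) (a b : Oct) :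
    DifferentiableAt ℝ (fun z => mul φ z a b) y :=
  ((differentiableAt_of_contDiffOn h.contDiffOn_mulL h.isOpen hy).clm_apply
    (differentiableAt_const a)).clm_apply (differentiableAt_const b)

/-- The real part of the product involves only the metric, and `∇g = 0`. -/
theorem IsG2On.covMul_fst (h : IsG2On φ U) (hy : y ∈ U) (i : Fin 7) (a b : Oct) :
    (covMul (mulL φ) (GamL φ) i y a b).1 = 0 := by
  have hg := fun k l => differentiableAt_of_contDiffOn (h.contDiffOn_g k l) h.isOpen hy
  have hd : pd i (fun z => a.1 * b.1 - ∑ k, ∑ l, g φ z k l * a.2 k * b.2 l) y =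
      -∑ k, ∑ l, pd i (fun z => g φ z k l) y * a.2 k * b.2 l := by
    have hs : DifferentiableAt ℝ (fun z => ∑ k, ∑ l, g φ z k l * a.2 k * b.2 l) y := by
      fun_prop
    rw [pd_eq_pdv, pdv_sub (differentiableAt_const _) hs, ← pd_eq_pdv, ← pd_eq_pdv,
      pd_sum (fun k => by fun_prop)]
    have : ∀ k, pd i (fun z => ∑ l, g φ z k l * a.2 k * b.2 l) y =
        ∑ l, pd i (fun z => g φ z k l) y * a.2 k * b.2 l := by
      intro k
      rw [pd_sum (fun l => by fun_prop)]
      refine Finset.sum_congr rfl fun l _ => ?_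
      rw [pd_mul_const (by fun_prop), pd_mul_const (hg k l)]
    have h₀ : pd i (fun _ => a.1 * b.1) y = 0 := by simp [pd]
    simp only [h₀, this, zero_sub]
  have e : (covMul (mulL φ) (GamL φ) i y a b).1 =
      pd i (fun z => a.1 * b.1 - ∑ k, ∑ l, g φ z k l * a.2 k * b.2 l) y
        + ∑ k, ∑ l, g φ y k l * (∑ m, Gam φ k i m y * a.2 m) * b.2 l
        + ∑ k, ∑ l, g φ y k l * a.2 k * ∑ m, Gam φ l i m y * b.2 m := by
    have hp : (pdv i (mulL φ) y a b).1 =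
        pd i (fun z => a.1 * b.1 - ∑ k, ∑ l, g φ z k l * a.2 k * b.2 l) y := by
      rw [h.pdv_mulL hy, pdv_fst (h.differentiableAt_mul hy a b)]
      rfl
    simp only [covMul, Prod.fst_sub, Prod.fst_add, hp, mulL_apply, GamL_apply, mul]
    ring
  have e₁ : ∑ k, ∑ l, (∑ m, Gam φ m i k y * g φ y m l) * a.2 k * b.2 l =
      ∑ k, ∑ l, g φ y k l * (∑ m, Gam φ k i m y * a.2 m) * b.2 l := by
    simp only [Finset.sum_mul, Finset.mul_sum]
    rw [sum_rotate₃]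
    refine Finset.sum_congr rfl fun m _ => ?_
    rw [Finset.sum_comm]
    exact Finset.sum_congr rfl fun l _ => Finset.sum_congr rfl fun k _ => by ring
  have e₂ : ∑ k, ∑ l, (∑ m, Gam φ m i l y * g φ y k m) * a.2 k * b.2 l =
      ∑ k, ∑ l, g φ y k l * a.2 k * ∑ m, Gam φ l i m y * b.2 m := by
    simp only [Finset.sum_mul, Finset.mul_sum]
    refine Finset.sum_congr rfl fun k _ => ?_
    rw [Finset.sum_comm]
    exact Finset.sum_congr rfl fun l _ => Finset.sum_congr rfl fun m _ => by ring
  rw [e, hd]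
  simp only [h.pd_g hy, add_mul, Finset.sum_add_distrib, e₁, e₂]
  ring

theorem IsFrame.sum_g_mul_cross (h : IsFrame φ y L) (α β : Fin 7 → ℝ) (l : Fin 7) :
    ∑ k, g φ y l k * cross φ y α β k = ∑ p, ∑ q, φ y p q l * α p * β q := by
  simp only [cross]
  exact h.sum_g_mul_gInv l fun l => ∑ i, ∑ j, φ y i j l * α i * β j

/-- The relation `g(α × β, ∂ₗ) = φ(α, β, ∂ₗ)` is differentiated. As `∇g = 0`, lowering the index of
the derivative of the cross product gives `∇φ`. -/
theorem IsG2On.sum_g_mul_covMul_snd (h : IsG2On φ U) (hy : y ∈ U) (i l : Fin 7) (a b : Oct) :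
    ∑ k, g φ y l k * (covMul (mulL φ) (GamL φ) i y a b).2 k =
      ∑ p, ∑ q, nablaPhi φ i p q l y * a.2 p * b.2 q := by
  obtain ⟨L, hL⟩ := h.frame y hy
  obtain ⟨r, α⟩ := a
  obtain ⟨s, β⟩ := b
  have hg := fun k l => differentiableAt_of_contDiffOn (h.contDiffOn_g k l) h.isOpen hy
  have hφ := fun p q l => differentiableAt_of_contDiffOn (h.smooth p q l) h.isOpen hy
  have hc := fun k => differentiableAt_of_contDiffOn (h.contDiffOn_cross α β k) h.isOpen hy
  have e : ∀ k, (covMul (mulL φ) (GamL φ) i y (r, α) (s, β)).2 k =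
      pd i (fun z => cross φ z α β k) y + ∑ m, Gam φ k i m y * cross φ y α β m
      - cross φ y (fun k => ∑ m, Gam φ k i m y * α m) β k
      - cross φ y α (fun k => ∑ m, Gam φ k i m y * β m) k := by
    intro k
    have hd : pd i (fun z => r * β k + s * α k + cross φ z α β k) y =
        pd i (fun z => cross φ z α β k) y := by
      have h₀ : pdv i (fun _ => r * β k + s * α k) y = 0 := by simp [pdv]
      rw [pd_eq_pdv, pdv_add (differentiableAt_const _) (hc k), h₀, zero_add]
      rfl
    have hp : (pdv i (mulL φ) y (r, α) (s, β)).2 k = pd i (fun z => cross φ z α β k) y := by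
      rw [h.pdv_mulL hy, pdv_snd (h.differentiableAt_mul hy _ _), ← hd]
      rfl
    simp only [covMul, Prod.snd_sub, Prod.snd_add, Pi.sub_apply, Pi.add_apply, hp,
      mulL_apply, GamL_apply, mul, Pi.smul_apply, smul_eq_mul, mul_add,
      Finset.sum_add_distrib, mul_left_comm _ r, mul_left_comm _ s, ← Finset.mul_sum]
    ring
  have hk : ∑ k, pd i (fun z => g φ z l k) y * cross φ y α β k +
      ∑ k, g φ y l k * pd i (fun z => cross φ z α β k) y =
      ∑ p, ∑ q, pd i (fun z => φ z p q l) y * α p * β q := by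
    have h₁ : pd i (fun z => ∑ k, g φ z l k * cross φ z α β k) y =
        pd i (fun z => ∑ p, ∑ q, φ z p q l * α p * β q) y :=
      pdv_congr h.isOpen hy (fun z hz => by
        obtain ⟨L, hL⟩ := h.frame z hz
        exact hL.sum_g_mul_cross α β l) i
    rw [pd_sum (fun k => by fun_prop), pd_sum (fun k => by fun_prop)] at h₁
    simp only [pd_mul (hg l _) (hc _), Finset.sum_add_distrib] at h₁
    rw [h₁]
    refine Finset.sum_congr rfl fun p _ => ?_
    rw [pd_sum (fun q => by fun_prop)]
    refine Finset.sum_congr rfl fun q _ => ?_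
    rw [pd_mul_const (by fun_prop), pd_mul_const (hφ p q l)]
  have e₁ : ∑ k, g φ y l k * ∑ m, Gam φ k i m y * cross φ y α β m =
      ∑ k, (∑ m, Gam φ m i k y * g φ y l m) * cross φ y α β k := by
    simp only [Finset.sum_mul, Finset.mul_sum]
    rw [Finset.sum_comm]
    exact Finset.sum_congr rfl fun l _ => Finset.sum_congr rfl fun m _ => by ring
  have e₂ : ∑ k, (∑ m, Gam φ m i l y * g φ y m k) * cross φ y α β k =
      ∑ p, ∑ q, (∑ m, Gam φ m i l y * φ y p q m) * α p * β q := by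
    simp only [Finset.sum_mul, mul_assoc]
    rw [Finset.sum_comm]
    simp only [← Finset.mul_sum, hL.sum_g_mul_cross]
    simp only [Finset.mul_sum]
    symm
    rw [sum_rotate₃]
    simp only [mul_assoc]
  simp only [e, mul_sub, mul_add, Finset.sum_sub_distrib, Finset.sum_add_distrib,
    hL.sum_g_mul_cross, e₁]
  simp only [h.pd_g hy, add_mul, Finset.sum_add_distrib, e₂] at hk
  simp only [nablaPhi, sub_mul, add_mul, Finset.sum_add_distrib, Finset.sum_sub_distrib, ← hk]
  have e₃ : ∑ p, ∑ q, φ y p q l * (∑ m, Gam φ p i m y * α m) * β q =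
      ∑ p, ∑ q, (∑ m, Gam φ m i p y * φ y m q l) * α p * β q := by
    simp only [Finset.sum_mul, Finset.mul_sum]
    rw [sum_rotate₃]
    refine Finset.sum_congr rfl fun m _ => ?_
    rw [Finset.sum_comm]
    exact Finset.sum_congr rfl fun l _ => Finset.sum_congr rfl fun k _ => by ring
  have e₄ : ∑ p, ∑ q, φ y p q l * α p * ∑ m, Gam φ q i m y * β m =
      ∑ p, ∑ q, (∑ m, Gam φ m i q y * φ y p m l) * α p * β q := by
    simp only [Finset.sum_mul, Finset.mul_sum]
    refine Finset.sum_congr rfl fun k _ => ?_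
    rw [Finset.sum_comm]
    exact Finset.sum_congr rfl fun l _ => Finset.sum_congr rfl fun m _ => by ring
  rw [e₃, e₄]
  ring

theorem mulVec_of_sum_g_mul (h : IsFrame φ y L) {x w : Fin 7 → ℝ}
    (hx : ∀ l, ∑ k, g φ y l k * x k = w l) : L *ᵥ x = fun c => ∑ l, L⁻¹ l c * w l := by
  have hx' : (Lᵀ * L) *ᵥ x = w := by
    ext l
    rw [← h.g_eq]
    exact hx l
  have : L⁻¹ᵀ *ᵥ ((Lᵀ * L) *ᵥ x) = L *ᵥ x := by
    rw [Matrix.mulVec_mulVec, ← Matrix.mul_assoc, ← Matrix.transpose_mul,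
      Matrix.mul_nonsing_inv _ h.1, Matrix.transpose_one, Matrix.one_mul]
  rw [← this, hx']
  rfl

theorem inv_mulVec_mulVec (h : IsFrame φ y L) (x : Fin 7 → ℝ) : L⁻¹ *ᵥ (L *ᵥ x) = x := by
  rw [Matrix.mulVec_mulVec, Matrix.nonsing_inv_mul _ h.1, Matrix.one_mulVec]

theorem sum_toFrame (h : IsFrame φ y L) (N : Fin 7 → Fin 7 → Fin 7 → ℝ) (α β : Fin 7 → ℝ)
    (c : Fin 7) : ∑ a, ∑ b, toFrame L N a b c * ((L *ᵥ α) a * (L *ᵥ β) b) =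
      ∑ l, L⁻¹ l c * ∑ p, ∑ q, N p q l * α p * β q := by
  have hα : ∀ p, ∑ a, L⁻¹ p a * (L *ᵥ α) a = α p := fun p => congrFun (inv_mulVec_mulVec h α) p
  have hβ : ∀ p, ∑ b, L⁻¹ p b * (L *ᵥ β) b = β p := fun p => congrFun (inv_mulVec_mulVec h β) p
  simp only [← hα, ← hβ]
  generalize L *ᵥ α = α'
  generalize L *ᵥ β = β'
  simp only [toFrame, Finset.sum_mul, Finset.mul_sum]
  refine (Finset.sum_congr rfl fun a _ => Finset.sum_congr rfl fun b _ => sum_rotate₃ _).trans ?_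
  rw [sum_rotate₃]
  refine Finset.sum_congr rfl fun r _ => ?_
  rw [sum_rotate₃]
  refine Finset.sum_congr rfl fun p _ => ?_
  rw [sum_rotate₃]
  refine Finset.sum_congr rfl fun q _ => ?_
  rw [Finset.sum_comm]
  exact Finset.sum_congr rfl fun a _ => Finset.sum_congr rfl fun b _ => by ring

/-- The bilinear map `ℝ⁷ × ℝ⁷ → ℝ⁷` given by a 3-tensor. -/
def bilin (n : Fin 7 → Fin 7 → Fin 7 → ℝ) (u v : Fin 7 → ℝ) : Fin 7 → ℝ :=
  fun c => ∑ a, ∑ b, n a b c * (u a * v b)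

theorem IsG2On.octFrame_covMul (h : IsG2On φ U) (hy : y ∈ U) (hL : IsFrame φ y L) (i : Fin 7)
    (a b : Oct) : octFrame L (covMul (mulL φ) (GamL φ) i y a b) =
      (0, bilin (toFrame L fun p q l => nablaPhi φ i p q l y) (L *ᵥ a.2) (L *ᵥ b.2)) := by
  ext c
  · exact h.covMul_fst hy i a b
  · simp only [octFrame]
    rw [mulVec_of_sum_g_mul hL fun l => h.sum_g_mul_covMul_snd hy i l a b, bilin, sum_toFrame hL]

/-- For fixed `u` the operator `v ↦ n(u, u × v) + u × n(u, v)` is zero. Its trace is `-2 X(u, u)`,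
so the quadratic form of `X` vanishes, and polarization gives the skewness of `X`. -/
theorem antisymm_of_alternative {n : Fin 7 → Fin 7 → Fin 7 → ℝ}
    (h₂ : ∀ a b c, n a c b = -n a b c)
    (hn : ∀ u v, bilin n u (cross0 u v) + cross0 u (bilin n u v) = 0) (p q : Fin 7) :
    ∑ b, ∑ c, (phiZ p b c : ℝ) * n q b c + ∑ b, ∑ c, (phiZ q b c : ℝ) * n p b c = 0 := by
  set X : Fin 7 → Fin 7 → ℝ := fun p q => ∑ b, ∑ c, (phiZ p b c : ℝ) * n q b c with hX
  have hQ : ∀ u : Fin 7 → ℝ, ∑ p, ∑ q, X p q * (u p * u q) = 0 := by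
    intro u
    have e₁ : ∑ b, bilin n u (cross0 u (Pi.single b 1)) b =
        -∑ p, ∑ q, X p q * (u p * u q) := by
      have : ∀ b c, cross0 u (Pi.single b 1) c = ∑ p, (phiZ p b c : ℝ) * u p := by
        intro b c
        simp [cross0, Pi.single_apply]
      simp only [bilin, this, hX, Finset.sum_mul, Finset.mul_sum, ← Finset.sum_neg_distrib]
      rw [Finset.sum_comm]
      refine (Finset.sum_congr rfl fun q _ => sum_rotate₃ _).trans ?_
      rw [Finset.sum_comm]
      refine Finset.sum_congr rfl fun p _ => Finset.sum_congr rfl fun q _ =>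
        Finset.sum_congr rfl fun b _ => Finset.sum_congr rfl fun c _ => ?_
      rw [h₂ q b c]
      ring
    have e₂ : ∑ b, cross0 u (bilin n u (Pi.single b 1)) b =
        -∑ p, ∑ q, X p q * (u p * u q) := by
      have : ∀ b c, bilin n u (Pi.single b 1) c = ∑ p, n p b c * u p := by
        intro b c
        simp [bilin, Pi.single_apply]
      simp only [cross0, this, hX, Finset.sum_mul, Finset.mul_sum, ← Finset.sum_neg_distrib]
      rw [Finset.sum_comm]
      refine Finset.sum_congr rfl fun p _ => ?_
      rw [sum_rotate₃]
      refine Finset.sum_congr rfl fun q _ => Finset.sum_congr rfl fun b _ =>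
        Finset.sum_congr rfl fun c _ => ?_
      rw [phiZ_swap₂₃ p b c]
      push_cast
      ring
    have e : ∑ b, (bilin n u (cross0 u (Pi.single b 1)) + cross0 u (bilin n u (Pi.single b 1))) b
        = 0 := by
      simp only [hn, Pi.zero_apply, Finset.sum_const_zero]
    simp only [Pi.add_apply, Finset.sum_add_distrib, e₁, e₂] at e
    linarith
  have hs : ∀ p, X p p = 0 := fun p => by
    simpa [Pi.single_apply] using hQ (Pi.single p 1)
  have hpq := hQ (Pi.single p 1 + Pi.single q 1)
  simp [Pi.single_apply, mul_add, Finset.sum_add_distrib, hs] at hpq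
  linarith

theorem octFrame_mul_assoc (hL : IsFrame φ y L) (A B C : Oct) :
    octFrame L (mul φ y (mul φ y A B) C - mul φ y A (mul φ y B C)) =
      (0, bilin (fun a b c => 2 * ∑ m, (psiZ m a b c : ℝ) * (L *ᵥ C.2) m)
        (L *ᵥ A.2) (L *ᵥ B.2)) := by
  have hs : ∀ A B, octFrame L (A - B) = octFrame L A - octFrame L B := fun A B => by
    simp [octFrame, Matrix.mulVec_sub]
  simp only [hs, octFrame_mul hL, mul0_assoc]
  rfl

end

/-! ### Alternativity and the torsion equation -/

section

section Alternative

variable {E : Type*} [NormedAddCommGroup E] [NormedSpace ℝ E] {μ : R7 → E →L[ℝ] E →L[ℝ] E}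
  {Γ : Fin 7 → R7 → E →L[ℝ] E} {U : Set R7} {y : R7}

/-- This is the covariant derivative of `a(ab) = (aa)b`. The partial derivatives obey the
differentiated law `hd`, and the connection terms cancel by the law itself and its polarization. -/
theorem covMul_alternative (hU : IsOpen U) (hy : y ∈ U) (hμ : DifferentiableAt ℝ μ y)
    (halt : ∀ z ∈ U, ∀ a b, μ z a (μ z a b) = μ z (μ z a a) b) (i : Fin 7) (a b : E) :
    covMul μ Γ i y a (μ y a b) + μ y a (covMul μ Γ i y a b) =
      covMul μ Γ i y (μ y a a) b + μ y (covMul μ Γ i y a a) b := by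
  have hd : pdv i μ y a (μ y a b) + μ y a (pdv i μ y a b) =
      pdv i μ y (μ y a a) b + μ y (pdv i μ y a a) b := by
    have h := pdv_congr hU hy (fun z hz => halt z hz a b) i
    have ha := hμ.clm_apply (differentiableAt_const a)
    have hab := fun b => ha.clm_apply (differentiableAt_const b)
    rw [pdv_clm_apply (c := fun z => μ z a) ha (hab b),
      pdv_clm_apply_const (c := fun z => μ z (μ z a a)) (hμ.clm_apply (hab a)),
      pdv_clm_apply hμ (hab a), pdv_clm_apply_const (c := fun z => μ z a) ha,
      pdv_clm_apply_const (c := fun z => μ z a) ha, pdv_clm_apply_const hμ] at h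
    simpa [_root_.add_apply] using h
  have hp : ∀ c, μ y a (μ y c b) + μ y c (μ y a b) = μ y (μ y a c) b + μ y (μ y c a) b := by
    intro c
    -- Polarization: the terms linear in `c` are isolated. The direction needed later is `c = Γ i y
    -- a`.
    have h := halt y hy (a + c) b
    simp only [map_add, _root_.add_apply, halt y hy a b, halt y hy c b] at h
    have := congrArg (fun x => x - μ y (μ y a a) b - μ y (μ y c c) b) h
    convert this using 1 <;> abel
  have h₁ := hp (Γ i y a)
  have h₂ := halt y hy a (Γ i y b)
  simp only [covMul, map_sub, map_add, _root_.sub_apply, _root_.add_apply, halt y hy a b, h₂]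
  rw [← sub_eq_zero] at hd h₁ ⊢
  have := congrArg₂ (· - ·) hd h₁
  simp only [sub_zero] at this
  rw [← this]
  abel

end Alternative

variable {φ : Form3} {U : Set R7} {y : R7} {L : Matrix (Fin 7) (Fin 7) ℝ}

theorem bilin_self {n : Fin 7 → Fin 7 → Fin 7 → ℝ} (h₁ : ∀ a b c, n b a c = -n a b c)
    (u : Fin 7 → ℝ) : bilin n u u = 0 := by
  ext c
  have h : bilin n u u c = -bilin n u u c := by
    simp only [bilin, ← Finset.sum_neg_distrib]
    rw [Finset.sum_comm]
    refine Finset.sum_congr rfl fun a _ => Finset.sum_congr rfl fun b _ => ?_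
    rw [h₁ a b c]
    ring
  exact self_eq_neg.1 h

theorem bilin_zero_left (n : Fin 7 → Fin 7 → Fin 7 → ℝ) (u : Fin 7 → ℝ) : bilin n 0 u = 0 := by
  ext c
  simp [bilin]

theorem cross0_eq_bilin (u v : Fin 7 → ℝ) :
    cross0 u v = bilin (fun a b c => (phiZ a b c : ℝ)) u v := rfl

theorem cross0_self (u : Fin 7 → ℝ) : cross0 u u = 0 :=
  bilin_self (fun a b c => by rw [phiZ_swap₁₂ a b c]; push_cast; rfl) u

theorem octFrame_zero : octFrame L 0 = 0 := by
  simp [octFrame]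

theorem octFrame_inv (h : IsFrame φ y L) (A : Oct) : octFrame L (A.1, L⁻¹ *ᵥ A.2) = A := by
  simp [octFrame, Matrix.mulVec_mulVec, Matrix.mul_nonsing_inv _ h.1]

theorem octFrame_add (A C : Oct) : octFrame L (A + C) = octFrame L A + octFrame L C := by
  simp [octFrame, Matrix.mulVec_add]

theorem octFrame_sub (A C : Oct) : octFrame L (A - C) = octFrame L A - octFrame L C := by
  simp [octFrame, Matrix.mulVec_sub]

theorem octFrame_neg (A : Oct) : octFrame L (-A) = -octFrame L A := by
  simp [octFrame, Matrix.mulVec_neg]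

theorem octFrame_smul (r : ℝ) (A : Oct) : octFrame L (r • A) = r • octFrame L A := by
  simp [octFrame, Matrix.mulVec_smul]

theorem octFrame_sum {ι : Type*} (s : Finset ι) (A : ι → Oct) :
    octFrame L (∑ i ∈ s, A i) = ∑ i ∈ s, octFrame L (A i) := by
  let f : Oct →+ Oct := ⟨⟨octFrame L, octFrame_zero⟩, octFrame_add⟩
  exact map_sum f A s

theorem mul_mul_self (h : IsFrame φ y L) (a b : Oct) :
    mul φ y a (mul φ y a b) = mul φ y (mul φ y a a) b := by
  have e := octFrame_mul_assoc h a a b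
  rw [bilin_self, ← Prod.zero_eq_mk, ← octFrame_zero (L := L)] at e
  · exact (sub_eq_zero.1 (octFrame_injective h e)).symm
  · intro a b c
    simp only [← mul_neg, ← Finset.sum_neg_distrib]
    congr 1
    refine Finset.sum_congr rfl fun m _ => ?_
    rw [(psiZ_swap m a b c).2.1]
    push_cast
    ring

/-- For imaginary `u` the square `uu` is real, and the derivative of the product vanishes on real
arguments and on `(u, u)`. The right side of `covMul_alternative` is therefore zero. -/
theorem IsG2On.octFrame_covMul_eq (h : IsG2On φ U) (hy : y ∈ U) (hL : IsFrame φ y L) (i : Fin 7)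
    (u v : Fin 7 → ℝ) :
    bilin (toFrame L fun p q l => nablaPhi φ i p q l y) u (cross0 u v) +
      cross0 u (bilin (toFrame L fun p q l => nablaPhi φ i p q l y) u v) = 0 := by
  have hμ := differentiableAt_of_contDiffOn h.contDiffOn_mulL h.isOpen hy
  have e := covMul_alternative (Γ := GamL φ) h.isOpen hy hμ (fun z hz a b => by
    obtain ⟨L, hL⟩ := h.frame z hz
    exact mul_mul_self hL a b) i (0, L⁻¹ *ᵥ u) (0, L⁻¹ *ᵥ v)
  have e' := congrArg (octFrame L) e
  have hu : L *ᵥ (L⁻¹ *ᵥ u) = u := congrArg Prod.snd (octFrame_inv hL (0, u))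
  have hv : L *ᵥ (L⁻¹ *ᵥ v) = v := congrArg Prod.snd (octFrame_inv hL (0, v))
  have hm : ∀ A C, L *ᵥ (mul φ y A C).2 = (mul0 (octFrame L A) (octFrame L C)).2 :=
    fun A C => congrArg Prod.snd (octFrame_mul hL A C)
  have hs : ∀ w, bilin (toFrame L fun p q l => nablaPhi φ i p q l y) w w = 0 :=
    bilin_self (toFrame_swap₁₂ (h.nablaPhi_swap₁₂ hy i))
  simp only [octFrame_add, mulL_apply, octFrame_mul hL, h.octFrame_covMul hy hL, hm] at e'
  have e₂ := congrArg Prod.snd e'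
  simpa [octFrame, mul0, hu, hv, hs, cross0_self, bilin_zero_left, cross0_eq_bilin 0] using e₂

/-- This is `∇ₐφ_{bcd} = 2Tₐᵉψ_{ebcd}` with `b, c, d` read in the frame. -/
theorem IsG2On.toFrame_nablaPhi (h : IsG2On φ U) (hy : y ∈ U) (hL : IsFrame φ y L)
    (i a b c : Fin 7) : toFrame L (fun p q l => nablaPhi φ i p q l y) a b c =
      2 * ∑ m, (psiZ m a b c : ℝ) * (L *ᵥ fun m => tors φ i m y) m := by
  have h₁ := toFrame_swap₁₂ (L := L) (h.nablaPhi_swap₁₂ hy i)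
  have h₂ := toFrame_swap₂₃ (L := L) (h.nablaPhi_swap₂₃ hy i)
  exact torsion_of_antisymm h₁ h₂ (antisymm_of_alternative h₂ (h.octFrame_covMul_eq hy hL i))
    (mulVec_tors hL i) a b c

/-- The derivative of the product is `∇φ = 2Tψ`, and `2ψ` is exactly the tensor of the associator
(`mul0_assoc`). -/
theorem IsG2On.covMul_eq (h : IsG2On φ U) (hy : y ∈ U) (i : Fin 7) (a b : Oct) :
    covMul (mulL φ) (GamL φ) i y a b = mulL φ y (mulL φ y a b) (T φ i y) -
      mulL φ y a (mulL φ y b (T φ i y)) := by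
  obtain ⟨L, hL⟩ := h.frame y hy
  refine octFrame_injective hL ?_
  simp only [mulL_apply]
  rw [h.octFrame_covMul hy hL, octFrame_mul_assoc hL]
  have : toFrame L (fun p q l => nablaPhi φ i p q l y) =
      fun a b c => 2 * ∑ m, (psiZ m a b c : ℝ) * (L *ᵥ (T φ i y).2) m := by
    ext a b c
    exact h.toFrame_nablaPhi hy hL i a b c
  rw [this]

end

/-! ### Curvature, the exterior derivative of the torsion, and Ricci -/

section

variable {φ : Form3} {U : Set R7} {y : R7} {L : Matrix (Fin 7) (Fin 7) ℝ}

variable (φ) in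
/-- The curvature endomorphism `R(∂ᵢ, ∂ⱼ)` as a matrix. -/
def curvMat (i j : Fin 7) (y : R7) : Matrix (Fin 7) (Fin 7) ℝ :=
  Matrix.of fun k l => curv φ k l i j y

theorem IsG2On.pdv_GamL (h : IsG2On φ U) (hy : y ∈ U) (i j : Fin 7) (A : Oct) :
    pdv i (GamL φ j) y A = (0, fun k => ∑ l, pd i (Gam φ k j l) y * A.2 l) := by
  have hΓ := differentiableAt_of_contDiffOn (h.contDiffOn_GamL j) h.isOpen hy
  have hG := fun k l => differentiableAt_of_contDiffOn (h.contDiffOn_Gam k j l) h.isOpen hy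
  have hA := hΓ.clm_apply (differentiableAt_const A)
  rw [← pdv_clm_apply_const hΓ]
  ext k
  · rw [pdv_fst hA]
    simp [GamL_apply, pd]
  · rw [pdv_snd hA]
    simp only [GamL_apply]
    rw [pd_sum (fun l => (hG k l).mul_const _)]
    exact Finset.sum_congr rfl fun l _ => pd_mul_const (hG k l) _ _

theorem IsG2On.curvOp_GamL (h : IsG2On φ U) (hy : y ∈ U) (i j : Fin 7) (A : Oct) :
    curvOp (GamL φ) i j y A = (0, curvMat φ i j y *ᵥ A.2) := by
  simp only [curvOp, h.pdv_GamL hy, GamL_apply]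
  ext k
  · simp
  · have e : ∀ i j, ∑ l, Gam φ k i l y * ∑ m, Gam φ l j m y * A.2 m =
        ∑ m, (∑ l, Gam φ k i l y * Gam φ l j m y) * A.2 m := by
      intro i j
      simp only [Finset.mul_sum, Finset.sum_mul, ← mul_assoc]
      exact Finset.sum_comm
    simp only [Prod.snd_add, Prod.snd_sub, Pi.add_apply, Pi.sub_apply, e,
      ← Finset.sum_sub_distrib, ← Finset.sum_add_distrib, Matrix.mulVec, dotProduct, curvMat,
      Matrix.of_apply, curv]
    exact Finset.sum_congr rfl fun l _ => by rw [Finset.sum_sub_distrib]; ring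

theorem IsG2On.dD_T (h : IsG2On φ U) (hy : y ∈ U) (i j : Fin 7) : dD φ (T φ) i j y =
    covD (mulL φ) (GamL φ) (T φ) i (T φ j) y - covD (mulL φ) (GamL φ) (T φ) j (T φ i) y := by
  have hT := fun i => differentiableAt_of_contDiffOn (h.contDiffOn_T i) h.isOpen hy
  rw [dD, D_eq_covD (hT j), D_eq_covD (hT i)]

theorem IsFrame.mul_im_fst_comm (h : IsFrame φ y L) (α β : Fin 7 → ℝ) :
    (mul φ y (0, α) (0, β)).1 = (mul φ y (0, β) (0, α)).1 := by
  simp only [mul]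
  congr 1
  rw [Finset.sum_comm]
  refine Finset.sum_congr rfl fun i _ => Finset.sum_congr rfl fun j _ => ?_
  rw [h.g_comm j i]
  ring

/-- The real parts of `TⱼTᵢ` and `TᵢTⱼ` are both minus the inner product of the two vectors, so they
cancel. -/
theorem IsFrame.dD_T_fst (h : IsFrame φ y L) (i j : Fin 7) : (dD φ (T φ) i j y).1 = 0 := by
  simp only [dD, D, Prod.fst_sub, nabla, T, h.mul_im_fst_comm (fun m => tors φ i m y)]
  simp [pd]

variable (φ L) in
/-- The curvature endomorphism `R(∂ᵢ, ∂ⱼ)` in a frame. -/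
def frameCurv (i j : Fin 7) (y : R7) : Matrix (Fin 7) (Fin 7) ℝ := L * curvMat φ i j y * L⁻¹

theorem IsG2On.frameCurv_defect (h : IsG2On φ U) (hy : y ∈ U) (hL : IsFrame φ y L) (i j : Fin 7)
    (u v : Fin 7 → ℝ) : ((0, frameCurv φ L i j y *ᵥ cross0 u v) : Oct) -
      mul0 (0, frameCurv φ L i j y *ᵥ u) (0, v) - mul0 (0, u) (0, frameCurv φ L i j y *ᵥ v) =
      (0, bilin (fun a b c => 2 * ∑ m, (psiZ m a b c : ℝ) * (L *ᵥ (dD φ (T φ) i j y).2) m) u v) := by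
  have e := curvOp_mul h.isOpen hy h.contDiffOn_mulL h.contDiffOn_GamL h.contDiffOn_T
    (fun z hz => h.covMul_eq hz) i j (0, L⁻¹ *ᵥ u) (0, L⁻¹ *ᵥ v)
  rw [← h.dD_T hy] at e
  have e' := congrArg (octFrame L) e
  have hu : octFrame L (0, L⁻¹ *ᵥ u) = (0, u) := octFrame_inv hL (0, u)
  have hv : octFrame L (0, L⁻¹ *ᵥ v) = (0, v) := octFrame_inv hL (0, v)
  have hc : ∀ A, octFrame L (curvOp (GamL φ) i j y A) =
      (0, frameCurv φ L i j y *ᵥ (octFrame L A).2) := by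
    intro A
    rw [h.curvOp_GamL hy]
    simp only [octFrame, frameCurv, ← Matrix.mulVec_mulVec, inv_mulVec_mulVec hL]
  simp only [mulL_apply] at e'
  rw [octFrame_mul_assoc hL] at e'
  simp only [octFrame_sub, octFrame_mul hL, hc, hu, hv] at e'
  have hu' : L *ᵥ (L⁻¹ *ᵥ u) = u := congrArg Prod.snd hu
  have hv' : L *ᵥ (L⁻¹ *ᵥ v) = v := congrArg Prod.snd hv
  rw [hu', hv'] at e'
  simpa [mul0] using e'

/-- The real component of the derivation defect: associators are imaginary and the real part of a
product is minus the inner product, so the curvature preserves the inner product infinitesimally. -/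
theorem IsG2On.frameCurv_skew (h : IsG2On φ U) (hy : y ∈ U) (hL : IsFrame φ y L)
    (i j c d : Fin 7) : frameCurv φ L i j y c d = -frameCurv φ L i j y d c := by
  have e := congrArg Prod.fst (h.frameCurv_defect hy hL i j (Pi.single c 1) (Pi.single d 1))
  simp [mul0] at e
  linarith

theorem IsG2On.mulVec_dD_T (h : IsG2On φ U) (hy : y ∈ U) (hL : IsFrame φ y L)
    (i j m : Fin 7) : (L *ᵥ (dD φ (T φ) i j y).2) m =
      1 / 4 * ∑ c, ∑ d, (phiZ m c d : ℝ) * frameCurv φ L i j y c d := by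
  refine eq_of_derivation_defect (q := L *ᵥ (dD φ (T φ) i j y).2)
    (fun c d => h.frameCurv_skew hy hL i j c d) (fun a b l => ?_) m
  have e := congrFun (congrArg Prod.snd
    (h.frameCurv_defect hy hL i j (Pi.single a 1) (Pi.single b 1))) l
  have h₁ : cross0 (Pi.single a 1) (Pi.single b 1) = fun c => (phiZ a b c : ℝ) := by
    ext c
    simp [cross0, Pi.single_apply]
  have h₂ : ∀ w, cross0 w (Pi.single b 1) l = ∑ c, w c * (phiZ c b l : ℝ) := by
    intro w
    simp [cross0, Pi.single_apply, mul_comm]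
  have h₃ : ∀ w, cross0 (Pi.single a 1) w l = ∑ c, w c * (phiZ a c l : ℝ) := by
    intro w
    simp [cross0, Pi.single_apply, mul_comm]
  have h₄ : ∀ n, bilin n (Pi.single a 1) (Pi.single b 1) l = n a b l := by
    intro n
    simp [bilin, Pi.single_apply]
  simp only [mul0, Prod.snd_sub, Pi.sub_apply, zero_smul, zero_add, h₁, h₂, h₃, h₄] at e
  rw [← e]
  simp only [Matrix.mulVec_single_one, Matrix.col_apply]
  simp [Matrix.mulVec, dotProduct, mul_comm]

theorem IsFrame.Riem_eq (h : IsFrame φ y L) (i j k l : Fin 7) :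
    Riem φ i j k l y = (Lᵀ * frameCurv φ L i j y * L) k l := by
  have : Lᵀ * frameCurv φ L i j y * L = g φ y * curvMat φ i j y := by
    rw [h.g_eq, frameCurv]
    simp only [Matrix.mul_assoc, Matrix.nonsing_inv_mul _ h.1, Matrix.mul_one]
  rw [this]
  rfl

theorem IsFrame.sum_inv_Riem (h : IsFrame φ y L) (i j c d : Fin 7) :
    ∑ k, ∑ l, L⁻¹ k c * L⁻¹ l d * Riem φ i j k l y = frameCurv φ L i j y c d := by
  have : frameCurv φ L i j y = L⁻¹ᵀ * (Lᵀ * frameCurv φ L i j y * L) * L⁻¹ := by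
    rw [← Matrix.mul_assoc, ← Matrix.mul_assoc, ← Matrix.transpose_mul,
      Matrix.mul_nonsing_inv _ h.1, Matrix.transpose_one, Matrix.one_mul, Matrix.mul_assoc,
      Matrix.mul_nonsing_inv _ h.1, Matrix.mul_one]
  rw [this]
  simp only [Matrix.mul_apply (M := _ * _) (N := L⁻¹), Matrix.mul_apply (M := L⁻¹ᵀ),
    Matrix.transpose_apply, Finset.sum_mul, h.Riem_eq]
  rw [Finset.sum_comm]
  exact Finset.sum_congr rfl fun k _ => Finset.sum_congr rfl fun l _ => by ring

theorem Riem_swap₁₂ (i j k l : Fin 7) : Riem φ j i k l y = -Riem φ i j k l y := by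
  simp only [Riem, curv, ← Finset.sum_neg_distrib]
  refine Finset.sum_congr rfl fun m _ => ?_
  simp only [Finset.sum_sub_distrib]
  ring

theorem IsG2On.Riem_swap₃₄ (h : IsG2On φ U) (hy : y ∈ U) (i j k l : Fin 7) :
    Riem φ i j l k y = -Riem φ i j k l y := by
  obtain ⟨L, hL⟩ := h.frame y hy
  have hs : (frameCurv φ L i j y)ᵀ = -frameCurv φ L i j y := by
    ext c d
    exact h.frameCurv_skew hy hL i j d c
  have : (Lᵀ * frameCurv φ L i j y * L)ᵀ = -(Lᵀ * frameCurv φ L i j y * L) := by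
    rw [Matrix.transpose_mul, Matrix.transpose_mul, hs]
    simp [Matrix.mul_assoc]
  rw [hL.Riem_eq, hL.Riem_eq, ← Matrix.transpose_apply (_ * _) k l, this, Matrix.neg_apply]

theorem IsG2On.pd_Gam_comm (h : IsG2On φ U) (hy : y ∈ U) (a k i j : Fin 7) :
    pd a (Gam φ k i j) y = pd a (Gam φ k j i) y :=
  pdv_congr h.isOpen hy (fun _ hz => h.Gam_comm hz k i j) a

theorem IsG2On.curv_bianchi (h : IsG2On φ U) (hy : y ∈ U) (m i j l : Fin 7) :
    curv φ m l i j y + curv φ m i j l y + curv φ m j l i y = 0 := by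
  simp only [curv, Finset.sum_sub_distrib, h.pd_Gam_comm hy _ m j i, h.pd_Gam_comm hy _ m l i,
    h.pd_Gam_comm hy _ m l j, h.Gam_comm hy _ j i, h.Gam_comm hy _ l i, h.Gam_comm hy _ l j]
  ring

theorem IsG2On.Riem_bianchi (h : IsG2On φ U) (hy : y ∈ U) (i j k l : Fin 7) :
    Riem φ i j k l y + Riem φ j l k i y + Riem φ l i k j y = 0 := by
  simp only [Riem, ← Finset.sum_add_distrib, ← mul_add, h.curv_bianchi hy, mul_zero,
    Finset.sum_const_zero]

/-- The Ricci contraction keeps the second index free, so the Bianchi identity is needed for the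
other three; pair symmetry moves it there. -/
theorem IsG2On.Riem_cyclic (h : IsG2On φ U) (hy : y ∈ U) (i j k l : Fin 7) :
    Riem φ i j k l y + Riem φ k j l i y + Riem φ l j i k y = 0 := by
  have b := h.Riem_bianchi hy
  have s := h.Riem_swap₃₄ hy
  have r := fun i j k l => Riem_swap₁₂ (φ := φ) (y := y) i j k l
  -- The classical combination of four Bianchi identities, with skewness in each pair of indices.
  have pair : ∀ i j k l, Riem φ i j k l y = Riem φ k l i j y := by
    intro i j k l
    linarith [b i j k l, b j k l i, b k l i j, b l i j k, s i j k l, s j l k i, s l i k j,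
      s j k l i, s k i l j, s i j l k, s k l i j, s l j i k, s j k i l, s l i j k, s i k j l,
      s k l j i, r i j k l, r j l k i, r l i k j, r j k l i, r k i l j, r i j l k, r k l i j,
      r l j i k, r j k i l, r l i j k, r i k j l, r k l j i, r i k l j, r l j k i, r j l i k, r k i j l]
  rw [pair i j k l, pair k j l i, pair l j i k]
  linarith [b k l j i, b k l i j, b l i j k, s k l i j, s k l j i, s l i k j, s l i j k, s i k l j,
    s i k j l, r i k l j, pair k l j i]

theorem toFrame_cyclic {N : Fin 7 → Fin 7 → Fin 7 → ℝ}
    (hN : ∀ a b c, N a b c + N b c a + N c a b = 0) (a b c : Fin 7) :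
    toFrame L N a b c + toFrame L N b c a + toFrame L N c a b = 0 := by
  have e₁ : toFrame L N b c a =
      ∑ p, ∑ q, ∑ r, L⁻¹ p a * L⁻¹ q b * L⁻¹ r c * N q r p := by
    rw [toFrame, sum_rotate₃]
    exact Finset.sum_congr rfl fun p _ => Finset.sum_congr rfl fun q _ =>
      Finset.sum_congr rfl fun r _ => by ring
  have e₂ : toFrame L N c a b =
      ∑ p, ∑ q, ∑ r, L⁻¹ p a * L⁻¹ q b * L⁻¹ r c * N r p q := by
    rw [toFrame, sum_rotate₃, sum_rotate₃]
    exact Finset.sum_congr rfl fun p _ => Finset.sum_congr rfl fun q _ =>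
      Finset.sum_congr rfl fun r _ => by ring
  rw [e₁, e₂, toFrame]
  simp only [← Finset.sum_add_distrib, ← mul_add, hN, mul_zero, Finset.sum_const_zero]

theorem octFrame_deltaUp (h : IsFrame φ y L) (i : Fin 7) :
    octFrame L (deltaUp φ i y) = (0, fun c => L⁻¹ i c) := by
  rw [deltaUp_eq]
  ext c
  · rfl
  · simp only [octFrame, Matrix.mulVec, dotProduct]
    rw [← sum_gInv_mul h]
    exact Finset.sum_congr rfl fun l _ => mul_comm _ _

theorem octFrame_RicHat (h : IsFrame φ y L) (j : Fin 7) : octFrame L (RicHat φ j y) =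
    (0, fun c => ∑ a, toFrame L (fun i k l => Riem φ i j k l y) a a c) := by
  rw [RicHat, octFrame_sum]
  simp only [octFrame_smul, octFrame_deltaUp h]
  ext c
  · simp [Prod.fst_sum]
  · have hg : ∀ i k, gInv φ y i k = ∑ a, L⁻¹ i a * L⁻¹ k a := fun i k => by
      rw [h.gInv_eq]
      rfl
    simp only [Prod.snd_sum, Finset.sum_apply, Prod.smul_snd, Pi.smul_apply, smul_eq_mul, Ric,
      toFrame, hg, Finset.sum_mul]
    refine (Finset.sum_congr rfl fun l _ => sum_rotate₃ _).trans ?_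
    rw [Finset.sum_comm]
    refine Finset.sum_congr rfl fun a _ => ?_
    rw [← sum_rotate₃]
    exact Finset.sum_congr rfl fun i _ => Finset.sum_congr rfl fun k _ =>
      Finset.sum_congr rfl fun l _ => by ring

/-- By bilinearity the coefficients of the left factor move to the right one. With `K = L⁻¹` this
replaces `δⁱ` by the orthonormal basis. -/
theorem sum_mul0_im (K q : Fin 7 → Fin 7 → ℝ) : ∑ i, mul0 (0, K i) (0, q i) =
    ∑ a, mul0 (0, Pi.single a 1) (0, fun m => ∑ i, K i a * q i m) := by
  have e : ∀ (a : Fin 7) (x : Fin 7 → ℝ), mul0 (0, Pi.single a 1) (0, x) =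
      (-x a, fun l => ∑ m, (phiZ a m l : ℝ) * x m) := by
    intro a x
    ext l <;> simp [mul0, cross0, Pi.single_apply]
  simp only [e]
  ext c
  · simp only [Prod.fst_sum, mul0, dotProduct, mul_zero, zero_sub, Finset.sum_neg_distrib]
    rw [Finset.sum_comm]
  · simp only [Prod.snd_sum, mul0, zero_smul, zero_add, cross0, Finset.sum_apply, Finset.mul_sum]
    rw [← sum_rotate₃]

/-- The Ricci tensor is the Dirac contraction of the octonionic exterior derivative of the
torsion. -/
theorem IsG2On.half_RicHat (h : IsG2On φ U) (hy : y ∈ U) (j : Fin 7) :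
    (1 / 2 : ℝ) • RicHat φ j y = -∑ i, mul φ y (deltaUp φ i y) (dD φ (T φ) i j y) := by
  obtain ⟨L, hL⟩ := h.frame y hy
  refine octFrame_injective hL ?_
  -- Only the three contracted or output slots are read in the frame; `j` remains a coordinate
  -- index.
  set w := toFrame L fun i k l => Riem φ i j k l y with hw
  have hsw : ∀ a c d, w a c d = -w a d c := fun a c d =>
    toFrame_swap₂₃ (fun i k l => h.Riem_swap₃₄ hy i j k l) a d c
  have hcy : ∀ a c d, w a c d + w c d a + w d a c = 0 :=
    toFrame_cyclic fun i k l => h.Riem_cyclic hy i j k l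
  have hwK : ∀ a c d, w a c d = ∑ i, L⁻¹ i a * frameCurv φ L i j y c d := by
    intro a c d
    simp only [hw, toFrame, ← hL.sum_inv_Riem, Finset.mul_sum, mul_assoc]
  rw [octFrame_smul, octFrame_RicHat hL, ← hw, ← sum_mul0_eq_ricci hsw hcy, octFrame_neg,
    octFrame_sum]
  have hQ : ∀ i, octFrame L (mul φ y (deltaUp φ i y) (dD φ (T φ) i j y)) = mul0 (0, L⁻¹ i)
      (0, fun m => 1 / 4 * ∑ c, ∑ d, (phiZ m c d : ℝ) * frameCurv φ L i j y c d) := by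
    intro i
    rw [octFrame_mul hL, octFrame_deltaUp hL, octFrame, hL.dD_T_fst i j]
    congr 2
    ext m
    exact h.mulVec_dD_T hy hL i j m
  simp only [hQ]
  rw [sum_mul0_im (fun i => L⁻¹ i)]
  congr 1
  refine Finset.sum_congr rfl fun a _ => ?_
  congr 2
  ext m
  simp only [hwK, mul_left_comm _ (1 / 4 : ℝ), ← Finset.mul_sum]
  congr 1
  simp only [Finset.mul_sum]
  rw [sum_rotate₃]
  exact Finset.sum_congr rfl fun i _ => Finset.sum_congr rfl fun c _ =>
    Finset.sum_congr rfl fun d _ => by ring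

end

/-! ### The Dirac operator and the second equality -/

section

variable {φ : Form3} {U : Set R7} {y : R7} {L : Matrix (Fin 7) (Fin 7) ℝ}

theorem covD_neg_sum {E ι : Type*} [NormedAddCommGroup E] [NormedSpace ℝ E] [Fintype ι]
    {μ : R7 → E →L[ℝ] E →L[ℝ] E} {Γ : Fin 7 → R7 → E →L[ℝ] E} {t : Fin 7 → R7 → E}
    {f : ι → R7 → E} (hf : ∀ k, DifferentiableAt ℝ (f k) y) (i : Fin 7) :
    covD μ Γ t i (fun z => -∑ k, f k z) y = -∑ k, covD μ Γ t i (f k) y := by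
  have h : pdv i (fun z => -∑ k, f k z) y = -∑ k, pdv i (f k) y := by
    simp only [pdv, fderiv_fun_neg, fderiv_fun_sum fun k _ => hf k]
    simp
  simp only [covD, cov, h, map_neg, map_sum, _root_.neg_apply, _root_.sum_apply,
    Finset.sum_sub_distrib, Finset.sum_add_distrib]
  abel

/-- `∇g⁻¹ = 0`, from differentiating `g⁻¹g = 1` and using `∇g = 0`. -/
theorem IsG2On.pd_gInv (h : IsG2On φ U) (hy : y ∈ U) (j i k : Fin 7) :
    pd j (fun z => gInv φ z i k) y =
      -∑ m, gInv φ y i m * Gam φ k j m y - ∑ m, Gam φ i j m y * gInv φ y m k := by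
  obtain ⟨L, hL⟩ := h.frame y hy
  have hg := fun k l => differentiableAt_of_contDiffOn (h.contDiffOn_g k l) h.isOpen hy
  have hi := fun k l => differentiableAt_of_contDiffOn (h.contDiffOn_gInv k l) h.isOpen hy
  set G : Matrix (Fin 7) (Fin 7) ℝ := Matrix.of fun k m => Gam φ k j m y with hG
  set I' : Matrix (Fin 7) (Fin 7) ℝ := Matrix.of fun i k => pd j (fun z => gInv φ z i k) y with hI
  have e : I' * g φ y + gInv φ y * (Gᵀ * g φ y + g φ y * G) = 0 := by
    ext a b
    have hc : pd j (fun z => ∑ m, gInv φ z a m * g φ z m b) y = 0 := by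
      have := pdv_congr h.isOpen hy (f := fun z => ∑ m, gInv φ z a m * g φ z m b)
        (f' := fun _ => (1 : Matrix (Fin 7) (Fin 7) ℝ) a b) (fun z hz => by
          obtain ⟨L, hL⟩ := h.frame z hz
          rw [← hL.gInv_mul_g]
          rfl) j
      rw [pd_eq_pdv, this]
      simp [pdv]
    rw [pd_sum (fun m => (hi a m).fun_mul (hg m b))] at hc
    simp only [pd_mul (hi a _) (hg _ b), Finset.sum_add_distrib, h.pd_g hy] at hc
    rw [Matrix.add_apply, Matrix.mul_apply, Matrix.mul_apply, Matrix.zero_apply, ← hc]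
    simp only [hI, hG, Matrix.of_apply, Matrix.add_apply, Matrix.mul_apply, Matrix.transpose_apply,
      mul_comm (Gam φ _ j b y)]
  have e' : I' = -(gInv φ y * Gᵀ) - G * gInv φ y := by
    have := congrArg (· * gInv φ y) e
    simp only [Matrix.add_mul, Matrix.mul_add, Matrix.mul_assoc, hL.g_mul_gInv, Matrix.mul_one,
      Matrix.zero_mul] at this
    rw [← Matrix.mul_assoc (gInv φ y) (g φ y), hL.gInv_mul_g, Matrix.one_mul] at this
    rw [eq_neg_of_add_eq_zero_left this, neg_add, sub_eq_add_neg]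
  exact congrFun (congrFun e' i) k

/-- The tensor `δ` is parallel. Since `cov` ignores the form index `i`, the Christoffel term of that
index is what remains. -/
theorem IsG2On.cov_deltaUp (h : IsG2On φ U) (hy : y ∈ U) (j i : Fin 7) :
    cov (GamL φ) j (deltaUp φ i) y = -∑ k, Gam φ i j k y • deltaUp φ k y := by
  have hd := differentiableAt_of_contDiffOn (h.contDiffOn_deltaUp i) h.isOpen hy
  rw [cov]
  ext k
  · simp [pdv_fst hd, GamL_apply, deltaUp_eq, pd, Prod.fst_sum]
  · simp only [Prod.snd_add, Pi.add_apply, pdv_snd hd, GamL_apply, deltaUp_eq, h.pd_gInv hy,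
      Prod.snd_neg, Prod.snd_sum, Pi.neg_apply, Finset.sum_apply, Prod.smul_snd, Pi.smul_apply,
      smul_eq_mul, mul_comm (gInv φ y i _)]
    ring

theorem Dirac_one : Dirac φ one y =
    -∑ i, mulL φ y (deltaUp φ i y) (T φ i y) := by
  have hD : ∀ i, D φ i one y = -T φ i y := by
    intro i
    ext k
    · simp [D, nabla, one, mul, T, pd]
    · simp [D, nabla, one, mul, T, pd, cross]
  simp only [Dirac, hD, ← mulL_apply, map_neg, Finset.sum_neg_distrib]

/-- The Dirac contraction of the octonionic exterior derivative of the torsion in terms of the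
Dirac operator. -/
theorem IsG2On.sum_deltaUp_mul_dD (h : IsG2On φ U) (hy : y ∈ U) (j : Fin 7) :
    -∑ i, mul φ y (deltaUp φ i y) (dD φ (T φ) i j y) =
      -DiracForm φ (T φ) j y - D φ j (Dirac φ one) y := by
  have hμ := differentiableAt_of_contDiffOn h.contDiffOn_mulL h.isOpen hy
  have hT := fun i => differentiableAt_of_contDiffOn (h.contDiffOn_T i) h.isOpen hy
  have hδ := fun i => differentiableAt_of_contDiffOn (h.contDiffOn_deltaUp i) h.isOpen hy
  have hδT : ∀ i, DifferentiableAt ℝ (fun z => mulL φ z (deltaUp φ i z) (T φ i z)) y :=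
    fun i => (hμ.clm_apply (hδ i)).clm_apply (hT i)
  have he : ∀ z ∈ U, Dirac φ one z = -∑ i, mulL φ z (deltaUp φ i z) (T φ i z) :=
    fun z _ => Dirac_one
  have hd : DifferentiableAt ℝ (Dirac φ one) y :=
    (DifferentiableAt.fun_sum fun i _ => hδT i).neg.congr_of_eventuallyEq
      (Filter.eventuallyEq_of_mem (h.isOpen.mem_nhds hy) he)
  -- By `covD_mul`, `δⁱ` is differentiated by `∇` alone, and `Tᵢ` by `D`.
  have hD : D φ j (Dirac φ one) y = ∑ i, ∑ k, Gam φ i j k y • mulL φ y (deltaUp φ k y) (T φ i y) -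
      ∑ i, mulL φ y (deltaUp φ i y) (D φ j (T φ i) y) := by
    rw [D_eq_covD hd, covD_congr h.isOpen hy he, covD_neg_sum hδT]
    simp only [covD_mul hμ (h.covMul_eq hy j) (hδ _) (hT _), h.cov_deltaUp hy, ← D_eq_covD (hT _),
      map_neg, map_sum, map_smul, _root_.neg_apply, _root_.sum_apply, _root_.smul_apply,
      Finset.sum_add_distrib, Finset.sum_neg_distrib]
    abel
  have hF : DiracForm φ (T φ) j y = ∑ i, mulL φ y (deltaUp φ i y) (D φ i (T φ j) y) -
      ∑ i, ∑ k, Gam φ k i j y • mulL φ y (deltaUp φ i y) (T φ k y) := by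
    have : ∀ i, DForm φ i (T φ) j y = D φ i (T φ j) y - ∑ k, Gam φ k i j y • T φ k y := by
      intro i
      rw [DForm, D]
      abel
    simp only [DiracForm, this, ← mulL_apply, map_sub, map_sum, map_smul, Finset.sum_sub_distrib]
  -- After relabelling, the Christoffel terms from `δⁱ` and from the form index of `T` cancel
  -- because `Γ` is symmetric.
  rw [hD, hF, Finset.sum_comm]
  simp only [dD, ← mulL_apply, map_sub, Finset.sum_sub_distrib, h.Gam_comm hy _ j]
  abel

end

/-! ### From charts of the manifold to coordinate components -/

section

variable {M : Type*} [TopologicalSpace M] [ChartedSpace R7 M]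

theorem mfderiv_symm_injective {e : OpenPartialHomeomorph M R7}
    (he : e ∈ IsManifold.maximalAtlas (𝓡 7) ∞ M) {y : R7} (hy : y ∈ e.target) :
    Function.Injective (mfderiv (𝓡 7) (𝓡 7) e.symm y) := by
  have h₁ : MDifferentiableAt (𝓡 7) (𝓡 7) e.symm y :=
    ((contMDiffOn_symm_of_mem_maximalAtlas he).contMDiffAt
      (e.open_target.mem_nhds hy)).mdifferentiableAt (by simp)
  have h₂ : MDifferentiableAt (𝓡 7) (𝓡 7) e (e.symm y) :=
    ((contMDiffOn_of_mem_maximalAtlas he).contMDiffAt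
      (e.open_source.mem_nhds (e.map_target hy))).mdifferentiableAt (by simp)
  have hc := mfderiv_comp y h₂ h₁
  have hid : mfderiv (𝓡 7) (𝓡 7) (e ∘ e.symm) y = ContinuousLinearMap.id ℝ _ := by
    rw [← mfderiv_id (I := 𝓡 7) (x := y)]
    exact Filter.EventuallyEq.mfderiv_eq (Filter.eventuallyEq_of_mem (e.open_target.mem_nhds hy)
      fun z hz => e.right_inv hz)
  intro u v huv
  have := congrArg (mfderiv (𝓡 7) (𝓡 7) e (e.symm y)) huv
  rw [← ContinuousLinearMap.comp_apply, ← ContinuousLinearMap.comp_apply, ← hc, hid] at this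
  exact this

/-- The columns of `L` are the coordinate vectors in the model coordinates given by `positive`; `L`
is invertible because a chart has injective differential. -/
theorem isFrame_components [IsManifold (𝓡 7) ∞ M] (Φ : G2Structure M)
    {e : OpenPartialHomeomorph M R7}
    (he : e ∈ IsManifold.maximalAtlas (𝓡 7) ∞ M) {y : R7} (hy : y ∈ e.target) :
    ∃ L, IsFrame (components Φ e) y L := by
  obtain ⟨l, hl⟩ := Φ.positive (e.symm y)
  let f : R7 →ₗ[ℝ] R7 := l.toLinearMap ∘ₗ (mfderiv (𝓡 7) (𝓡 7) e.symm y).toLinearMap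
  have hf : Function.Injective f := l.injective.comp (mfderiv_symm_injective he hy)
  let b := (EuclideanSpace.basisFun (Fin 7) ℝ).toBasis
  refine ⟨LinearMap.toMatrix b b f, ?_, fun i j k => ?_⟩
  · rw [LinearMap.det_toMatrix]
    exact LinearMap.isUnit_det _ ((Module.End.isUnit_iff _).2
      ⟨hf, LinearMap.injective_iff_surjective.1 hf⟩)
  · have hcol : ∀ i, (LinearMap.toMatrix b b f).col i = l (coordVec e y i) := by
      intro i
      ext a
      simp [LinearMap.toMatrix_apply, b, f, coordVec]
      rfl
    rw [components, hl, phi0_eq_sum, triple]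
    simp only [hcol]

theorem isG2On_components [IsManifold (𝓡 7) ∞ M] (Φ : G2Structure M)
    {e : OpenPartialHomeomorph M R7}
    (he : e ∈ IsManifold.maximalAtlas (𝓡 7) ∞ M) : IsG2On (components Φ e) e.target where
  isOpen := e.open_target
  smooth := Φ.smooth e he
  frame _ hy := isFrame_components Φ he hy

end

end G2

end

/-- The equality of `Im 𝕆M`-valued 1-forms on `M`, in components in every smooth chart. -/
theorem mainTheorem5 (M : Type*) [TopologicalSpace M] [ChartedSpace R7 M]
    [IsManifold (𝓡 7) ∞ M] (Φ : G2Structure M)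
    (e : OpenPartialHomeomorph M R7) (he : e ∈ IsManifold.maximalAtlas (𝓡 7) ∞ M)
    (y : R7) (hy : y ∈ e.target) (j : Fin 7) :
    letI φ : G2.Form3 := G2.components Φ e
    (1 / 2 : ℝ) • G2.RicHat φ j y
        = -∑ i, G2.mul φ y (G2.deltaUp φ i y) (G2.dD φ (G2.T φ) i j y) ∧
      -∑ i, G2.mul φ y (G2.deltaUp φ i y) (G2.dD φ (G2.T φ) i j y)
        = -G2.DiracForm φ (G2.T φ) j y - G2.D φ j (G2.Dirac φ G2.one) y :=
  have h := G2.isG2On_components Φ he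
  ⟨h.half_RicHat hy j, h.sum_deltaUp_mul_dD hy j⟩
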